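/- A blind MDP is a tuple $P = (S, A, \delta, s_0)$ with a finite set $S$ of states, a finite set $A$ of actions, an initial state $s_0 \in S$ and, for all $s \in S$ and $a \in A$, a probability distribution $\delta(s,a)$ on $S$ (with rational probabilities, when $P$ is the input of an algorithm). A distribution $\tau$ on $A$, played at every step independently of the past, induces a probability measure $\mathbb{P}^{\tau}_{s_0}$ on infinite plays $(s_0, a_0, s_1, a_1, \ldots)$. For a target state $\top \in S$, let $\mathrm{Reach}(\top)$ be the event that $s_i = \top$ for some $i \ge 0$. A rank policy $\sigma$ is given by a rank $i(a) \in \mathbb{N} \cup \{\infty\}$ for every action $a$, not all of them $\infty$. For $\varepsilon > 0$ it defines the distribution $\sigma(\varepsilon)$ on $A$ given by $\sigma(\varepsilon)(a) = f(a,\varepsilon) / \sum_{a' \in A} f(a',\varepsilon)$, where $f(a,\varepsilon) = \varepsilon^{i(a)}$ if $i(a) < \infty$ and $f(a,\varepsilon) = 0$ if $i(a) = \infty$. It is a witness of limit-sure reachability if $$\lim_{\varepsilon \to 0^+} \mathbb{P}^{\sigma(\varepsilon)}_{s_0}\bigl(\mathrm{Reach}(\top)\bigr) = 1.$$ **Lemma.**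 There is a polynomial-time algorithm that, given a blind MDP, a target state $\top$ and a rank policy (with transition probabilities and ranks written in binary), decides whether the rank policy is a witness of limit-sure reachability or not. -/

import Mathlib

open MeasureTheory ProbabilityTheory Filter Topology
open scoped NNReal ENNReal

/-! ### Blind MDPs and the probability of reaching the target -/

/-- A blind MDP with set of states `Fin n`, set of actions `Fin m` and initial state `s₀`. The
transition probabilities are rational, so that a blind MDP is a finite object that can be given
to an algorithm. -/
structure BlindMDP (n m : ℕ) where
  δ : Fin n → Fin m → Fin n → ℚ≥0
  δ_sum : ∀ s a, ∑ s', δ s a s' = 1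
  s₀ : Fin n

namespace BlindMDP

variable {n m : ℕ}

/-- The distribution `δ(s, a)` over the successor states. -/
noncomputable def trans (M : BlindMDP n m) (s : Fin n) (a : Fin m) : PMF (Fin n) :=
  PMF.ofFintype (fun s' => ((M.δ s a s' : ℝ≥0) : ℝ≥0∞)) (by
    have h : ∑ s', (M.δ s a s' : ℝ≥0) = 1 := by exact_mod_cast M.δ_sum s a
    exact_mod_cast h)

/-- The law of the first state-action pair `(s₀, a₀)` of a play under the memoryless policy `σ`.
In a blind MDP, a memoryless policy is just a distribution over the actions. -/
noncomputable def first (M : BlindMDP n m) (σ : PMF (Fin m)) : PMF (Fin n × Fin m) :=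
  σ.map fun a => (M.s₀, a)

/-- The law of the next state-action pair, given the current one: the next state is drawn from
`δ(s, a)` and the next action is drawn from `σ`, independently. -/
noncomputable def next (M : BlindMDP n m) (σ : PMF (Fin m)) (sa : Fin n × Fin m) :
    PMF (Fin n × Fin m) :=
  (M.trans sa.1 sa.2).bind fun s' => σ.map fun a' => (s', a')

/-- `next`, as a Markov kernel from histories `(s₀, a₀, …, s_k, a_k)` to the pair
`(s_{k+1}, a_{k+1})`. -/
noncomputable def nextKernel (M : BlindMDP n m) (σ : PMF (Fin m)) (k : ℕ) :
    Kernel (Π _ : Finset.Iic k, Fin n × Fin m) (Fin n × Fin m) :=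
  Kernel.ofFunOfCountable fun h =>
    (M.next σ (h ⟨k, Finset.mem_Iic.2 le_rfl⟩)).toMeasure

instance (M : BlindMDP n m) (σ : PMF (Fin m)) (k : ℕ) : IsMarkovKernel (M.nextKernel σ k) :=
  ⟨fun h => PMF.toMeasure.isProbabilityMeasure
    (M.next σ (h ⟨k, Finset.mem_Iic.2 le_rfl⟩))⟩

/-- The probability measure on infinite plays `(s₀, a₀, s₁, a₁, …)` induced by the memoryless
policy `σ`. -/
noncomputable def playMeasure (M : BlindMDP n m) (σ : PMF (Fin m)) :
    Measure (ℕ → Fin n × Fin m) :=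
  Kernel.trajMeasure (X := fun _ => Fin n × Fin m) (M.first σ).toMeasure (M.nextKernel σ)

/-- The event that the state `target` is visited at least once. -/
def reach (target : Fin n) : Set (ℕ → Fin n × Fin m) :=
  {ω | ∃ i, (ω i).1 = target}

end BlindMDP

/-! ### Rank policies and witnesses -/

/-- A rank policy: every action `a` has the weight function `ε ↦ ε ^ i` if `rank a = some i`, and
the weight function that is constant to zero if `rank a = none`. -/
structure RankPolicy (m : ℕ) where
  rank : Fin m → Option ℕ
  exists_rank : ∃ a, rank a ≠ none

namespace RankPolicy

variable {m : ℕ}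

/-- The weight of the action `a` at the parameter `ε`, before normalization. -/
noncomputable def weight (σ : RankPolicy m) (ε : ℝ≥0) (a : Fin m) : ℝ≥0 :=
  match σ.rank a with
  | none => 0
  | some i => ε ^ i

/-- The memoryless policy `σ(ε)` for `ε > 0`, with
`σ(ε)(a) = weight ε a / ∑ a', weight ε a'`. -/
noncomputable def policy (σ : RankPolicy m) (ε : Set.Ioi (0 : ℝ≥0)) : PMF (Fin m) :=
  PMF.normalize (fun a => (σ.weight ε a : ℝ≥0∞))
    (by
      obtain ⟨a, ha⟩ := σ.exists_rank
      obtain ⟨i, hi⟩ := Option.ne_none_iff_exists'.1 ha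
      have hpos : (0 : ℝ≥0) < σ.weight ε a := by
        simp only [weight, hi]
        exact pow_pos ε.2 i
      intro h
      have h0 := ENNReal.tsum_eq_zero.1 h a
      exact hpos.ne' (by exact_mod_cast h0))
    (by
      rw [tsum_fintype]
      exact ENNReal.sum_ne_top.2 fun a _ => ENNReal.coe_ne_top)

/-- The rank policy `σ` is a witness of limit-sure reachability: the probability of reaching
`target` under `σ(ε)` tends to `1` as `ε → 0⁺`. -/
def IsWitness {n : ℕ} (σ : RankPolicy m) (M : BlindMDP n m) (target : Fin n) : Prop :=
  Tendsto (fun ε : Set.Ioi (0 : ℝ≥0) => M.playMeasure (σ.policy ε) (BlindMDP.reach target))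
    (comap Subtype.val (𝓝[>] 0)) (𝓝 1)

end RankPolicy

/-! ### Programs and their running time

Algorithms are programs of a small list-processing language whose only data are binary trees
(`nil`, and pairs of trees). The language has no primitives beyond building a pair, taking it
apart, testing for `nil`, and `while` loops. Time is counted at bit level: every instruction that
is executed costs the size of the tree that it is applied to. So `t` units of time can be simulated
by a Turing machine in time polynomial in `t`, and a Turing machine is simulated with polynomial
overhead by keeping its tape as two lists: polynomial time is the usual polynomial time. -/

/-- The data of programs. `x.numLeaves`, which is at least `1`, is used as the size of `x`. -/
abbrev Data : Type := BinaryTree Unit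

inductive Program : Type
  /-- the constant `nil` -/
  | const : Program
  /-- the argument itself -/
  | arg : Program
  /-- the left component of a pair (`nil` for `nil`) -/
  | head : Program
  /-- the right component of a pair (`nil` for `nil`) -/
  | tail : Program
  /-- the pair of the results of `f` and `g` -/
  | pair (f g : Program) : Program
  /-- first `f`, then `g` -/
  | seq (f g : Program) : Program
  /-- `f` if the result of `c` is not `nil`, and `g` otherwise -/
  | ite (c f g : Program) : Program
  /-- while the result of `c` on the current value is not `nil`, apply `f` to it -/
  | while (c f : Program) : Program

/-- `Runs f x y t`: the program `f`, on input `x`, halts with the output `y` after time `t`. -/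
inductive Runs : Program → Data → Data → ℕ → Prop
  | const (x : Data) : Runs .const x .nil x.numLeaves
  | arg (x : Data) : Runs .arg x x x.numLeaves
  | head (x : Data) : Runs .head x x.left x.numLeaves
  | tail (x : Data) : Runs .tail x x.right x.numLeaves
  | pair {f g : Program} {x y z : Data} {t u : ℕ} :
      Runs f x y t → Runs g x z u → Runs (.pair f g) x (.node () y z) (x.numLeaves + t + u)
  | seq {f g : Program} {x y z : Data} {t u : ℕ} :
      Runs f x y t → Runs g y z u → Runs (.seq f g) x z (x.numLeaves + t + u)
  | ite_true {c f g : Program} {x b y : Data} {t u : ℕ} :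
      Runs c x b t → b ≠ .nil → Runs f x y u → Runs (.ite c f g) x y (x.numLeaves + t + u)
  | ite_false {c f g : Program} {x y : Data} {t u : ℕ} :
      Runs c x .nil t → Runs g x y u → Runs (.ite c f g) x y (x.numLeaves + t + u)
  | while_true {c f : Program} {x b y z : Data} {t u v : ℕ} :
      Runs c x b t → b ≠ .nil → Runs f x y u → Runs (.while c f) y z v →
      Runs (.while c f) x z (x.numLeaves + t + u + v)
  | while_false {c f : Program} {x : Data} {t : ℕ} :
      Runs c x .nil t → Runs (.while c f) x x (x.numLeaves + t)

/-- Programs are deterministic. -/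
theorem Runs.unique {f : Program} {x y z : Data} {t u : ℕ} (h : Runs f x y t)
    (h' : Runs f x z u) : y = z ∧ t = u := by
  induction h generalizing z u with
  | const | arg | head | tail => cases h'; exact ⟨rfl, rfl⟩
  | pair _ _ ih₁ ih₂ =>
    cases h' with
    | pair h₁ h₂ =>
      obtain ⟨rfl, rfl⟩ := ih₁ h₁
      obtain ⟨rfl, rfl⟩ := ih₂ h₂
      exact ⟨rfl, rfl⟩
  | seq _ _ ih₁ ih₂ =>
    cases h' with
    | seq h₁ h₂ =>
      obtain ⟨rfl, rfl⟩ := ih₁ h₁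
      obtain ⟨rfl, rfl⟩ := ih₂ h₂
      exact ⟨rfl, rfl⟩
  | ite_true _ hb _ ih₁ ih₂ =>
    cases h' with
    | ite_true h₁ _ h₂ =>
      obtain ⟨rfl, rfl⟩ := ih₁ h₁
      obtain ⟨rfl, rfl⟩ := ih₂ h₂
      exact ⟨rfl, rfl⟩
    | ite_false h₁ _ => exact absurd (ih₁ h₁).1 hb
  | ite_false _ _ ih₁ ih₂ =>
    cases h' with
    | ite_true h₁ hb _ => exact absurd (ih₁ h₁).1.symm hb
    | ite_false h₁ h₂ =>
      obtain ⟨-, rfl⟩ := ih₁ h₁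
      obtain ⟨rfl, rfl⟩ := ih₂ h₂
      exact ⟨rfl, rfl⟩
  | while_true _ hb _ _ ih₁ ih₂ ih₃ =>
    cases h' with
    | while_true h₁ _ h₂ h₃ =>
      obtain ⟨rfl, rfl⟩ := ih₁ h₁
      obtain ⟨rfl, rfl⟩ := ih₂ h₂
      obtain ⟨rfl, rfl⟩ := ih₃ h₃
      exact ⟨rfl, rfl⟩
    | while_false h₁ => exact absurd (ih₁ h₁).1 hb
  | while_false _ ih₁ =>
    cases h' with
    | while_true h₁ hb _ _ => exact absurd (ih₁ h₁).1.symm hb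
    | while_false h₁ =>
      obtain ⟨-, rfl⟩ := ih₁ h₁
      exact ⟨rfl, rfl⟩

/-- There is a polynomial-time algorithm that decides `P` on the inputs of type `α`, given by
their encodings: one program that halts on the encoding of every `x : α` within time polynomial in
the size of that encoding, with an output other than `nil` (yes) if `P x` and with the output `nil`
(no) otherwise. -/
def DecidableInPolyTime {α : Type} (encode : α → Data) (P : α → Prop) : Prop :=
  ∃ (f : Program) (p : Polynomial ℕ), ∀ x : α, ∃ (y : Data) (t : ℕ),
    Runs f (encode x) y t ∧ t ≤ p.eval (encode x).numLeaves ∧ (y ≠ .nil ↔ P x)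

/-! ### Encoding of the inputs -/

namespace Data

def ofList : List Data → Data
  | [] => .nil
  | x :: l => .node () x (ofList l)

def ofBool : Bool → Data
  | false => .nil
  | true => .node () .nil .nil

/-- Natural numbers are written in binary, least significant bit first. -/
def ofNat (k : ℕ) : Data := ofList (k.bits.map ofBool)

/-- A fraction in lowest terms, as the pair of numerator and denominator. -/
def ofRat (q : ℚ≥0) : Data := .node () (ofNat q.num) (ofNat q.den)

def ofOption : Option ℕ → Data
  | none => .nil
  | some k => .node () .nil (ofNat k)

end Data

/-- An input of the algorithm: a blind MDP, a target state and a rank policy. -/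
structure VerifierInput where
  n : ℕ
  m : ℕ
  mdp : BlindMDP n m
  target : Fin n
  policy : RankPolicy m

/-- The list of: the table of the transition probabilities (row by row), the initial state, the
target state, and the list of the ranks of the actions. -/
def VerifierInput.encode (I : VerifierInput) : Data :=
  Data.ofList
    [Data.ofList (List.ofFn fun s => Data.ofList (List.ofFn fun a =>
        Data.ofList (List.ofFn fun s' => Data.ofRat (I.mdp.δ s a s')))),
      Data.ofNat I.mdp.s₀,
      Data.ofNat I.target,
      Data.ofList (List.ofFn fun a => Data.ofOption (I.policy.rank a))]

/-!
Under `σ(ε)` the states form a Markov chain. Up to a common factor, the rate of its transition from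
`s` to `s'` is the sum over the actions `a` of `ε ^ rank a * δ(s, a, s')`, so it is either zero or
of the order of magnitude `ε ^ i`, where `i` is the least rank of an action that makes the
transition possible. Whether the probability of reaching the target tends to `1` depends on these
exponents only, and they can be followed through an elimination of the states one after the other,
as in Gaussian elimination.

The probability of reaching the target is the least nonnegative supersolution of the equations
that say that the value of a state other than the target is the average of the values of its
successors (`BlindMDP.reachProb_le`). Multiplied by the total rate at which a state is left, the
equations are linear in the rates, and self-loops cancel. A state with the rates `v` is eliminated
by adding to each other row of rates its transitions through that state. If the row is first
multiplied by the rate `m` at which the eliminated state is left for something else, then a rate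
`x` becomes `x * m + a * y`, where `a` is the rate to the eliminated state and `y` the rate from
there. This needs neither subtraction nor division, and it does not change the supersolutions on
the other states (`RateRow.feasible_cons_iff`). A state that cannot be left is first given a
transition to a losing sink, so that `m ≠ 0`.

Since only sums and products of nonnegative numbers occur, the orders of magnitude of the new rates
are found from those of the old ones: products become sums of exponents and sums become minima
(`RowNear.elim`). The constants that compare a rate with a power of `ε` are independent of `ε`
(`exists_near_foldl_elimFirst`). At the end the starting point has a rate `t` for the target and a
rate `d` for the losing sink, the probability is `t / (d + t)`, and it tends to `1` if and only if
the exponent of `t` is smaller than that of `d` (`tendsto_one_iff_costLT`).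

Each elimination at most doubles the exponents, so their binary length grows by at most one bit and
stays polynomial (`CostRow.StateBounded.foldl_elimFirst`). For the running time, `PolyTime` is the
class of functions between encoded types that a program computes in polynomial time. It is closed
under composition, case distinctions and folds over lists with intermediate results of polynomial
size (`PolyTime.foldl`), and it contains the addition and the comparison of binary numbers.
-/

/-! ### Functions computable in polynomial time -/

/-- An encoding of the elements of `α` as inputs and outputs of programs. It need not be injective:
only the encodings that programs read and write matter. -/
class DataEncoding (α : Type) where
  enc : α → Data

/-- The size of the encoding of `x`. -/
def encSize {α : Type} [DataEncoding α] (x : α) : ℕ := (DataEncoding.enc x).numLeaves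

section PolyTime

open DataEncoding

variable {α β γ κ : Type} [DataEncoding α] [DataEncoding β] [DataEncoding γ] [DataEncoding κ]

theorem encSize_pos (x : α) : 0 < encSize x := BinaryTree.numLeaves_pos _

/-- `b x` is bounded by a polynomial in the size of `x`. -/
def PolyBounded (b : α → ℕ) : Prop := ∃ p : Polynomial ℕ, ∀ x, b x ≤ p.eval (encSize x)

theorem Polynomial.eval_mono_nat (p : Polynomial ℕ) {a b : ℕ} (h : a ≤ b) :
    p.eval a ≤ p.eval b := by
  simp only [Polynomial.eval_eq_sum, Polynomial.sum]
  gcongr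

namespace PolyBounded

theorem mono {a b : α → ℕ} (hb : PolyBounded b) (h : ∀ x, a x ≤ b x) : PolyBounded a := by
  obtain ⟨p, hp⟩ := hb
  exact ⟨p, fun x => (h x).trans (hp x)⟩

theorem const (k : ℕ) : PolyBounded fun _ : α => k := ⟨Polynomial.C k, fun _ => by simp⟩

theorem size : PolyBounded fun x : α => encSize x := ⟨Polynomial.X, fun _ => by simp⟩

theorem add {a b : α → ℕ} (ha : PolyBounded a) (hb : PolyBounded b) :
    PolyBounded fun x => a x + b x := by
  obtain ⟨p, hp⟩ := ha
  obtain ⟨q, hq⟩ := hb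
  exact ⟨p + q, fun x => by simpa using add_le_add (hp x) (hq x)⟩

theorem mul {a b : α → ℕ} (ha : PolyBounded a) (hb : PolyBounded b) :
    PolyBounded fun x => a x * b x := by
  obtain ⟨p, hp⟩ := ha
  obtain ⟨q, hq⟩ := hb
  exact ⟨p * q, fun x => by simpa using Nat.mul_le_mul (hp x) (hq x)⟩

theorem eval (p : Polynomial ℕ) {a : α → ℕ} (ha : PolyBounded a) :
    PolyBounded fun x => p.eval (a x) := by
  obtain ⟨q, hq⟩ := ha
  exact ⟨p.comp q, fun x => by
    simpa [Polynomial.eval_comp] using Polynomial.eval_mono_nat p (hq x)⟩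

theorem comp {b : β → ℕ} {f : α → β} (hb : PolyBounded b)
    (hf : PolyBounded fun x => encSize (f x)) : PolyBounded fun x => b (f x) := by
  obtain ⟨p, hp⟩ := hb
  exact (hf.eval p).mono fun x => hp (f x)

end PolyBounded

theorem BinaryTree.numLeaves_left_le (x : Data) : x.left.numLeaves ≤ x.numLeaves := by
  cases x <;> simp

theorem BinaryTree.numLeaves_right_le (x : Data) : x.right.numLeaves ≤ x.numLeaves := by
  cases x <;> simp

/-- The output of a program is not larger than its running time. -/
theorem Runs.numLeaves_le {f : Program} {x y : Data} {t : ℕ} (h : Runs f x y t) :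
    y.numLeaves ≤ t := by
  induction h with
  | const x => exact x.numLeaves_pos
  | arg => exact le_rfl
  | head x => exact x.numLeaves_left_le
  | tail x => exact x.numLeaves_right_le
  | pair _ _ ih₁ ih₂ => simp only [BinaryTree.numLeaves]; omega
  | seq | ite_true | ite_false | while_true | while_false => omega

/-- The function `f` is computed, on encodings, by a program that runs in polynomial time. -/
def PolyTime (f : α → β) : Prop :=
  ∃ (P : Program) (b : α → ℕ), PolyBounded b ∧
    ∀ x, ∃ t, Runs P (enc x) (enc (f x)) t ∧ t ≤ b x

instance : DataEncoding Data := ⟨id⟩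
instance : DataEncoding Unit := ⟨fun _ => .nil⟩
instance : DataEncoding Bool := ⟨Data.ofBool⟩
instance : DataEncoding (α × β) := ⟨fun p => .node () (enc p.1) (enc p.2)⟩
instance : DataEncoding (List α) := ⟨fun l => Data.ofList (l.map enc)⟩
instance : DataEncoding ℕ := ⟨Data.ofNat⟩
instance : DataEncoding (Option ℕ) := ⟨Data.ofOption⟩
instance : DataEncoding ℚ≥0 := ⟨Data.ofRat⟩

@[simp] theorem enc_true : enc true = .node () .nil .nil := rfl
@[simp] theorem enc_false : enc false = .nil := rfl
@[simp] theorem enc_pair (a : α) (b : β) : enc (a, b) = .node () (enc a) (enc b) := rfl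
@[simp] theorem enc_nil : enc ([] : List α) = .nil := rfl
@[simp] theorem enc_cons (a : α) (l : List α) : enc (a :: l) = .node () (enc a) (enc l) := rfl
@[simp] theorem enc_none : enc (none : Option ℕ) = .nil := rfl
@[simp] theorem enc_some (k : ℕ) : enc (some k) = .node () .nil (enc k) := rfl
theorem enc_nat (k : ℕ) : enc k = enc k.bits := rfl

@[simp] theorem encSize_true : encSize true = 2 := rfl
@[simp] theorem encSize_false : encSize false = 1 := rfl
@[simp] theorem encSize_pair (a : α) (b : β) : encSize (a, b) = encSize a + encSize b := rfl
@[simp] theorem encSize_nil : encSize ([] : List α) = 1 := rfl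
@[simp] theorem encSize_cons (a : α) (l : List α) :
    encSize (a :: l) = encSize a + encSize l := rfl
@[simp] theorem encSize_none : encSize (none : Option ℕ) = 1 := rfl
@[simp] theorem encSize_some (k : ℕ) : encSize (some k) = 1 + encSize k := rfl

theorem encSize_bool_le (b : Bool) : encSize b ≤ 2 := by cases b <;> simp

theorem length_lt_encSize (l : List α) : l.length < encSize l := by
  induction l with
  | nil => simp
  | cons a l ih => have := encSize_pos a; simp; omega

theorem encSize_le_of_mem {a : α} {l : List α} (h : a ∈ l) : encSize a ≤ encSize l := by
  induction l with
  | nil => simp at h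
  | cons b l ih =>
    rw [encSize_cons]
    rcases List.mem_cons.1 h with rfl | h
    · omega
    · have := ih h; omega

theorem encSize_list_le {l : List α} {B : ℕ} (h : ∀ a ∈ l, encSize a ≤ B) :
    encSize l ≤ l.length * B + 1 := by
  induction l with
  | nil => simp
  | cons a l ih =>
    have h1 := h a (by simp)
    have h2 := ih fun b hb => h b (by simp [hb])
    simp only [encSize_cons, List.length_cons]
    linarith

theorem encSize_append (l l' : List α) : encSize (l ++ l') + 1 = encSize l + encSize l' := by
  induction l with
  | nil => simp; omega
  | cons a l ih => simp only [List.cons_append, encSize_cons]; omega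

theorem encSize_reverse (l : List α) : encSize l.reverse = encSize l := by
  induction l with
  | nil => rfl
  | cons a l ih =>
    have := encSize_append l.reverse [a]
    simp only [List.reverse_cons, encSize_cons, encSize_nil] at this ⊢
    omega

theorem encSize_drop_le (l : List α) (k : ℕ) : encSize (l.drop k) ≤ encSize l := by
  have h1 := encSize_append (l.take k) (l.drop k)
  have h2 := encSize_pos (l.take k)
  rw [List.take_append_drop] at h1
  omega

namespace PolyTime

theorem polyBounded {f : α → β} (hf : PolyTime f) : PolyBounded fun x => encSize (f x) := by
  obtain ⟨P, b, hb, h⟩ := hf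
  refine hb.mono fun x => ?_
  obtain ⟨t, ht, htb⟩ := h x
  exact ht.numLeaves_le.trans htb

/-- The same program computes every function with the same encodings. -/
theorem congr_enc {f : α → β} {α' β' : Type} [DataEncoding α'] [DataEncoding β']
    (hf : PolyTime f) (i : α' → α) (g : α' → β') (hi : ∀ x, enc (i x) = enc x)
    (hg : ∀ x, enc (f (i x)) = enc (g x)) : PolyTime g := by
  obtain ⟨P, b, ⟨p, hp⟩, h⟩ := hf
  refine ⟨P, fun x => b (i x), ⟨p, fun x => ?_⟩, fun x => ?_⟩
  · have : encSize (i x) = encSize x := by simp [encSize, hi]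
    simpa [this] using hp (i x)
  · rw [← hi, ← hg]; exact h (i x)

theorem self : PolyTime fun x : α => x :=
  ⟨.arg, _, PolyBounded.size, fun _ => ⟨_, Runs.arg _, le_rfl⟩⟩

theorem comp {f : β → γ} {g : α → β} (hf : PolyTime f) (hg : PolyTime g) :
    PolyTime fun x => f (g x) := by
  have hg' := hg.polyBounded
  obtain ⟨P, b, hb, h⟩ := hf
  obtain ⟨Q, c, hc, k⟩ := hg
  refine ⟨.seq Q P, fun x => encSize x + c x + b (g x),
    (PolyBounded.size.add hc).add (hb.comp hg'), fun x => ?_⟩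
  obtain ⟨t, ht, htb⟩ := h (g x)
  obtain ⟨u, hu, hub⟩ := k x
  exact ⟨_, Runs.seq hu ht, by unfold encSize; beta_reduce; omega⟩

theorem pair {f : α → β} {g : α → γ} (hf : PolyTime f) (hg : PolyTime g) :
    PolyTime fun x => (f x, g x) := by
  obtain ⟨P, b, hb, h⟩ := hf
  obtain ⟨Q, c, hc, k⟩ := hg
  refine ⟨.pair P Q, fun x => encSize x + b x + c x, (PolyBounded.size.add hb).add hc,
    fun x => ?_⟩
  obtain ⟨t, ht, htb⟩ := h x
  obtain ⟨u, hu, hub⟩ := k x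
  exact ⟨_, Runs.pair ht hu, by unfold encSize; beta_reduce; omega⟩

theorem head : PolyTime fun x : Data => (x.left : Data) :=
  ⟨.head, _, PolyBounded.size, fun _ => ⟨_, Runs.head _, le_rfl⟩⟩

theorem tail : PolyTime fun x : Data => (x.right : Data) :=
  ⟨.tail, _, PolyBounded.size, fun _ => ⟨_, Runs.tail _, le_rfl⟩⟩

theorem fst : PolyTime fun x : α × β => x.1 :=
  head.congr_enc enc _ (fun _ => rfl) fun _ => rfl

theorem snd : PolyTime fun x : α × β => x.2 :=
  tail.congr_enc enc _ (fun _ => rfl) fun _ => rfl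

theorem const_data (d : Data) : PolyTime fun _ : α => d := by
  induction d with
  | nil => exact ⟨.const, _, PolyBounded.size, fun x => ⟨_, Runs.const _, le_rfl⟩⟩
  | node u l r hl hr => exact (hl.pair hr).congr_enc _ _ (fun _ => rfl) fun _ => rfl

theorem const (c : β) : PolyTime fun _ : α => c :=
  (const_data (enc c)).congr_enc _ _ (fun _ => rfl) fun _ => rfl

/-- Programs branch on whether the encoding of a result is `nil`. -/
theorem ite_enc {c : α → κ} {f g : α → β} {r : α → β} (hc : PolyTime c) (hf : PolyTime f)
    (hg : PolyTime g) (hrf : ∀ x, enc (c x) ≠ .nil → r x = f x)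
    (hrg : ∀ x, enc (c x) = .nil → r x = g x) : PolyTime r := by
  obtain ⟨C, a, ha, hc⟩ := hc
  obtain ⟨P, b, hb, hf⟩ := hf
  obtain ⟨Q, b', hb', hg⟩ := hg
  refine ⟨.ite C P Q, fun x => encSize x + a x + (b x + b' x),
    (PolyBounded.size.add ha).add (hb.add hb'), fun x => ?_⟩
  obtain ⟨s, hs, hsb⟩ := hc x
  by_cases h : enc (c x) = .nil
  · obtain ⟨t, ht, htb⟩ := hg x
    rw [h] at hs
    exact ⟨_, Runs.ite_false hs (hrg x h ▸ ht), by unfold encSize; beta_reduce; omega⟩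
  · obtain ⟨t, ht, htb⟩ := hf x
    exact ⟨_, Runs.ite_true hs h (hrf x h ▸ ht), by unfold encSize; beta_reduce; omega⟩

theorem cond {c : α → Bool} {f g : α → β} (hc : PolyTime c) (hf : PolyTime f)
    (hg : PolyTime g) : PolyTime fun x => bif c x then f x else g x :=
  ite_enc hc hf hg (fun _ h => by cases hx : c _ <;> simp_all)
    (fun _ h => by cases hx : c _ <;> simp_all)

theorem nil : PolyTime fun _ : α => ([] : List β) := const _

theorem cons {f : α → β} {l : α → List β} (hf : PolyTime f) (hl : PolyTime l) :
    PolyTime fun x => f x :: l x :=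
  (hf.pair hl).congr_enc _ _ (fun _ => rfl) fun _ => rfl

theorem list_tail {l : α → List β} (hl : PolyTime l) : PolyTime fun x => (l x).tail :=
  (tail.congr_enc enc (fun l : List β => l.tail) (fun _ => rfl)
    (fun l => by cases l <;> rfl)).comp hl

/-- A case distinction on the list `l x`. -/
theorem list_cases {l : α → List β} {f : α → γ} {g : α × (β × List β) → γ}
    (hl : PolyTime l) (hf : PolyTime f) (hg : PolyTime g) :
    PolyTime fun x => match l x with
      | [] => f x
      | a :: t => g (x, (a, t)) := by
  obtain ⟨C, a, ha, hc⟩ := hl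
  obtain ⟨P, b, hb, hf⟩ := hf
  obtain ⟨Q, b', ⟨p, hp⟩, hg⟩ := hg
  refine ⟨.ite C (.seq (.pair .arg C) Q) P,
    fun x => encSize x + a x + (b x + (encSize x + (encSize x + encSize x + a x) +
      p.eval (encSize x + a x))), ?_, fun x => ?_⟩
  · exact (PolyBounded.size.add ha).add (hb.add ((PolyBounded.size.add
      ((PolyBounded.size.add .size).add ha)).add ((PolyBounded.size.add ha).eval p)))
  · obtain ⟨s, hs, hsb⟩ := hc x
    rcases hx : l x with _ | ⟨y, u⟩
    · obtain ⟨t, ht, htb⟩ := hf x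
      rw [hx] at hs
      exact ⟨_, by simpa only [hx] using Runs.ite_false hs ht,
        by unfold encSize; beta_reduce; omega⟩
    · obtain ⟨t, ht, htb⟩ := hg (x, (y, u))
      have hsize := hs.numLeaves_le
      rw [hx] at hs hsize
      have h1 := htb.trans (hp _)
      have h2 : encSize (x, (y, u)) ≤ encSize x + a x := by
        have : encSize (x, (y, u)) = encSize x + (enc (y :: u)).numLeaves := rfl
        omega
      have h3 := Polynomial.eval_mono_nat p h2
      refine ⟨_, by simpa only [hx] using
        Runs.ite_true hs (by simp) (Runs.seq (Runs.pair (Runs.arg _) hs) ht), ?_⟩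
      unfold encSize at *
      beta_reduce
      omega

theorem list_headD {l : α → List β} (hl : PolyTime l) {f : α → β} (hf : PolyTime f) :
    PolyTime fun x => (l x).headD (f x) := by
  refine (list_cases hl hf (fst.comp snd)).congr_enc _ _ (fun _ => rfl) fun x => ?_
  cases l x <;> rfl

/-- A `while` loop runs in polynomial time if it has polynomially many iterations and the values
that it goes through are of polynomial size. -/
theorem iterate {c : β → κ} {f : β → β} {i : α → β} {N B : α → ℕ} (hi : PolyTime i)
    (hc : PolyTime c) (hf : PolyTime f) (hN : PolyBounded N) (hB : PolyBounded B)
    (hsize : ∀ x, ∀ k ≤ N x, encSize (f^[k] (i x)) ≤ B x)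
    (hne : ∀ x, ∀ k < N x, enc (c (f^[k] (i x))) ≠ .nil)
    (hend : ∀ x, enc (c (f^[N x] (i x))) = .nil) : PolyTime fun x => f^[N x] (i x) := by
  obtain ⟨C, a, ⟨p, hp⟩, hc⟩ := hc
  obtain ⟨P, b, ⟨q, hq⟩, hf⟩ := hf
  obtain ⟨I, d, hd, hi⟩ := hi
  refine ⟨.seq I (.while C P),
    fun x => encSize x + d x + (N x + 1) * (B x + p.eval (B x) + q.eval (B x)),
    (PolyBounded.size.add hd).add
      ((hN.add (.const 1)).mul ((hB.add (hB.eval p)).add (hB.eval q))), fun x => ?_⟩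
  have key : ∀ j ≤ N x, ∃ t,
      Runs (.while C P) (enc (f^[N x - j] (i x))) (enc (f^[N x] (i x))) t ∧
      t ≤ (j + 1) * (B x + p.eval (B x) + q.eval (B x)) := by
    intro j
    induction j with
    | zero =>
      intro _
      obtain ⟨t, ht, htb⟩ := hc (f^[N x] (i x))
      rw [hend] at ht
      have h1 := hsize x (N x) le_rfl
      have h2 := htb.trans ((hp _).trans (Polynomial.eval_mono_nat p h1))
      refine ⟨_, Runs.while_false ht, ?_⟩
      unfold encSize at h1
      rw [zero_add, one_mul, Nat.sub_zero]
      omega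
    | succ j ih =>
      intro hj
      obtain ⟨v, hv, hvb⟩ := ih (by omega)
      obtain ⟨t, ht, htb⟩ := hc (f^[N x - (j + 1)] (i x))
      obtain ⟨u, hu, hub⟩ := hf (f^[N x - (j + 1)] (i x))
      have h1 := hsize x (N x - (j + 1)) (by omega)
      have h2 := htb.trans ((hp _).trans (Polynomial.eval_mono_nat p h1))
      have h3 := hub.trans ((hq _).trans (Polynomial.eval_mono_nat q h1))
      have h4 : f (f^[N x - (j + 1)] (i x)) = f^[N x - j] (i x) := by
        rw [← Function.iterate_succ_apply' f, show (N x - (j + 1)).succ = N x - j by omega]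
      rw [h4] at hu
      refine ⟨_, Runs.while_true ht (hne x _ (by omega)) hu hv, ?_⟩
      unfold encSize at h1
      rw [show j + 1 + 1 = (j + 1) + 1 from rfl, add_mul (j + 1) 1, one_mul]
      omega
  obtain ⟨t, ht, htb⟩ := key (N x) le_rfl
  obtain ⟨u, hu, hub⟩ := hi x
  rw [Nat.sub_self, Function.iterate_zero_apply] at ht
  exact ⟨_, Runs.seq hu ht, by unfold encSize; beta_reduce; omega⟩

/-- A fold over a list runs in polynomial time if its step does and if its intermediate results
are of polynomial size. -/
theorem foldl {l : α → List β} {b : α → γ} {F : α → γ → β → γ} {B : α → ℕ} (hl : PolyTime l)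
    (hb : PolyTime b) (hF : PolyTime fun p : α × (γ × β) => F p.1 p.2.1 p.2.2)
    (hB : PolyBounded B)
    (hsize : ∀ x k, encSize (((l x).take k).foldl (F x) (b x)) ≤ B x) :
    PolyTime fun x => (l x).foldl (F x) (b x) := by
  obtain ⟨S, hS⟩ : ∃ S : α × (γ × List β) → α × (γ × List β),
    S = fun s => match s.2.2 with
      | [] => s
      | y :: t => (s.1, (F s.1 s.2.1 y, t)) := ⟨_, rfl⟩
  have hSpoly : PolyTime S := by
    rw [hS]
    refine list_cases (g := fun q => (q.1.1, (F q.1.1 q.1.2.1 q.2.1, q.2.2)))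
      (snd.comp snd) self ?_
    exact (fst.comp fst).pair ((hF.comp ((fst.comp fst).pair
      (((fst.comp snd).comp fst).pair (fst.comp snd)))).pair (snd.comp snd))
  have hS' : ∀ x g y t, S (x, (g, y :: t)) = (x, (F x g y, t)) := fun x g y t => by rw [hS]
  have hiter : ∀ (x : α) (k : ℕ) (g : γ) (l : List β), k ≤ l.length →
      S^[k] (x, (g, l)) = (x, ((l.take k).foldl (F x) g, l.drop k)) := by
    intro x k
    induction k with
    | zero => simp
    | succ k ih =>
      intro g l hk
      cases l with
      | nil => simp at hk
      | cons y t =>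
        rw [Function.iterate_succ_apply, hS', ih _ _ (by simpa using hk)]
        rfl
  have h := iterate (i := fun x => (x, (b x, l x))) (N := fun x => (l x).length)
    (B := fun x => encSize x + (B x + encSize (l x))) (self.pair (hb.pair hl)) (snd.comp snd)
    hSpoly (hl.polyBounded.mono fun x => (length_lt_encSize _).le)
    (PolyBounded.size.add (hB.add hl.polyBounded)) (fun x k hk => ?_) (fun x k hk => ?_)
    (fun x => ?_)
  · refine ((fst.comp snd).comp h).congr_enc _ _ (fun _ => rfl) fun x => ?_
    simp only [hiter x _ _ _ le_rfl, List.take_length]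
  · rw [hiter x _ _ _ hk]
    have h1 := hsize x k
    have h2 := encSize_drop_le (l x) k
    simp only [encSize_pair]
    omega
  · rw [hiter x _ _ _ hk.le]
    simp only
    cases hd : (l x).drop k with
    | nil => simp at hd; omega
    | cons y t => simp
  · rw [hiter x _ _ _ le_rfl]
    simp

/-- A version of `PolyTime.foldl` for intermediate results that grow by a bounded amount in every
step. -/
theorem foldl_of_add_le {l : α → List β} {b : α → γ} {F : α → γ → β → γ} {B : α → ℕ}
    (hl : PolyTime l) (hb : PolyTime b)
    (hF : PolyTime fun p : α × (γ × β) => F p.1 p.2.1 p.2.2) (hB : PolyBounded B)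
    (hsize : ∀ x, ∀ y ∈ l x, ∀ g, encSize (F x g y) ≤ encSize g + B x) :
    PolyTime fun x => (l x).foldl (F x) (b x) := by
  refine hl.foldl hb hF (hb.polyBounded.add (hl.polyBounded.mul hB)) fun x k => ?_
  have key : ∀ (t : List β) (g : γ), (∀ y ∈ t, y ∈ l x) →
      encSize (t.foldl (F x) g) ≤ encSize g + t.length * B x := by
    intro t
    induction t with
    | nil => simp
    | cons y t ih =>
      intro g hmem
      have h1 := ih (F x g y) fun z hz => hmem z (by simp [hz])
      have h2 := hsize x y (hmem y (by simp)) g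
      simp only [List.foldl_cons, List.length_cons]
      linarith
  refine (key _ _ fun y hy => List.mem_of_mem_take hy).trans ?_
  have : ((l x).take k).length ≤ encSize (l x) :=
    (List.length_take_le' _ _).trans (length_lt_encSize _).le
  gcongr

theorem reverse {l : α → List β} (hl : PolyTime l) : PolyTime fun x => (l x).reverse := by
  have h : PolyTime fun x => (l x).foldl (fun (g : List β) y => y :: g) [] :=
    hl.foldl_of_add_le (B := fun x => encSize (l x)) nil
      ((snd.comp snd).cons (fst.comp snd)) hl.polyBounded fun x y hy g => by
        have := encSize_le_of_mem hy
        rw [encSize_cons]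
        omega
  simpa using h

theorem map {l : α → List β} {F : α → β → γ} (hl : PolyTime l)
    (hF : PolyTime fun p : α × β => F p.1 p.2) : PolyTime fun x => (l x).map (F x) := by
  obtain ⟨p, hp⟩ := hF.polyBounded
  have h : PolyTime fun x => (l x).foldl (fun (g : List γ) y => F x y :: g) [] :=
    hl.foldl_of_add_le (B := fun x => p.eval (encSize x + encSize (l x))) nil
      ((hF.comp (fst.pair (snd.comp snd))).cons (fst.comp snd))
      ((PolyBounded.size.add hl.polyBounded).eval p) fun x y hy g => by
        have h1 := encSize_le_of_mem hy
        have h2 := hp (x, y)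
        have h3 := Polynomial.eval_mono_nat p
          (show encSize (x, y) ≤ encSize x + encSize (l x) by rw [encSize_pair]; omega)
        rw [encSize_cons]
        simp only at h2
        omega
  refine h.reverse.congr_enc _ _ (fun _ => rfl) fun x => ?_
  rw [← List.reverse_reverse ((l x).map (F x))]
  congr 2
  generalize l x = t
  have key : ∀ (t : List β) (g : List γ), t.foldl (fun g y => F x y :: g) g
      = (t.map (F x)).reverse ++ g := by
    intro t
    induction t with
    | nil => simp
    | cons y t ih => intro g; simp [ih]
  simp [key]

theorem zipWith {l : α → List β} {l' : α → List κ} {F : α → β → κ → γ} (hl : PolyTime l)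
    (hl' : PolyTime l') (hF : PolyTime fun p : α × (β × κ) => F p.1 p.2.1 p.2.2) :
    PolyTime fun x => List.zipWith (F x) (l x) (l' x) := by
  obtain ⟨G, hG⟩ : ∃ G : List (β × κ) × List κ → β → List (β × κ) × List κ,
    G = fun g y => match g.2 with
      | [] => g
      | z :: t => ((y, z) :: g.1, t) := ⟨_, rfl⟩
  have hGpoly : PolyTime fun p : α × ((List (β × κ) × List κ) × β) => G p.2.1 p.2.2 := by
    rw [hG]
    exact list_cases (g := fun q : (α × ((List (β × κ) × List κ) × β)) × (κ × List κ) =>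
      ((q.1.2.2, q.2.1) :: q.1.2.1.1, q.2.2)) ((snd.comp fst).comp snd) (fst.comp snd)
      (((((snd.comp snd).comp fst).pair (fst.comp snd)).cons
        ((fst.comp (fst.comp snd)).comp fst)).pair (snd.comp snd))
  have h : PolyTime fun x => (l x).foldl G (([] : List (β × κ)), l' x) := by
    refine hl.foldl_of_add_le (B := fun x => encSize (l x)) (nil.pair hl') hGpoly
      hl.polyBounded fun x y hy g => ?_
    have := encSize_le_of_mem hy
    rcases g with ⟨g, _ | ⟨z, t⟩⟩ <;> simp only [hG, encSize_pair, encSize_cons, encSize_nil] <;>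
      omega
  refine (((fst.comp h).reverse).map (F := fun x (p : β × κ) => F x p.1 p.2) hF).congr_enc _ _
    (fun _ => rfl) fun x => ?_
  congr 1
  have key : ∀ (t : List β) (t' : List κ) (g : List (β × κ)),
      (t.foldl G (g, t')).1 = (t.zip t').reverse ++ g := by
    intro t
    induction t with
    | nil => simp
    | cons y t ih =>
      rintro (_ | ⟨z, t'⟩) g
      · rw [List.foldl_cons, show G (g, []) y = (g, []) by rw [hG], ih]
        simp
      · rw [List.foldl_cons, show G (g, z :: t') y = ((y, z) :: g, t') by rw [hG], ih]
        simp
  simp [key, List.zip, List.map_zipWith]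

end PolyTime

end PolyTime

/-! ### Binary arithmetic in polynomial time -/

section Arithmetic

open DataEncoding

variable {α β : Type} [DataEncoding α] [DataEncoding β]

theorem encSize_nat_le_of_lt {n k : ℕ} (h : n < 2 ^ k) : encSize n ≤ 2 * k + 1 := by
  have h1 : encSize n = encSize n.bits := rfl
  have h2 := encSize_list_le (l := n.bits) (B := 2) fun b _ => encSize_bool_le b
  have h3 := Nat.size_le.2 h
  rw [Nat.size_eq_bits_len] at h2
  omega

theorem lt_two_pow_encSize (n : ℕ) : n < 2 ^ encSize n := by
  have h1 : encSize n = encSize n.bits := rfl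
  have h2 := length_lt_encSize n.bits
  rw [Nat.size_eq_bits_len] at h2
  exact (Nat.lt_size_self n).trans_le (Nat.pow_le_pow_right (by norm_num) (by omega))

theorem encSize_bit_le (b : Bool) (n : ℕ) : encSize (Nat.bit b n) ≤ encSize n + 2 := by
  have h : encSize (b :: n.bits) ≤ encSize n + 2 := by
    have := encSize_bool_le b
    rw [encSize_cons, show encSize n = encSize n.bits from rfl]
    omega
  by_cases hb : n = 0 → b = true
  · rw [show encSize (Nat.bit b n) = encSize (Nat.bit b n).bits from rfl,
      Nat.bits_append_bit _ _ hb]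
    exact h
  · push Not at hb
    obtain ⟨rfl, hb⟩ := hb
    obtain rfl : b = false := by simpa using hb
    simp

theorem encSize_div2_le (n : ℕ) : encSize n.div2 ≤ encSize n := by
  rw [show encSize n.div2 = encSize n.div2.bits from rfl, Nat.div2_bits_eq_tail,
    show encSize n = encSize n.bits from rfl, ← List.drop_one]
  exact encSize_drop_le _ _

/-- Moves as many pairs of last binary digits as `l` has elements (which are not looked at) from the
pair of numbers `s.1` to the front of the list `s.2`. -/
def digitPairs {γ : Type} (l : List γ) (s : (ℕ × ℕ) × List (Bool × Bool)) :
    (ℕ × ℕ) × List (Bool × Bool) :=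
  l.foldl (fun s _ => ((s.1.1.div2, s.1.2.div2), (s.1.1.bodd, s.1.2.bodd) :: s.2)) s

def pushDigits (n : ℕ × ℕ) (d : Bool × Bool) : ℕ × ℕ := (Nat.bit d.1 n.1, Nat.bit d.2 n.2)

theorem foldl_pushDigits_digitPairs {γ : Type} (l : List γ) (s : (ℕ × ℕ) × List (Bool × Bool)) :
    (digitPairs l s).2.foldl pushDigits (digitPairs l s).1 = s.2.foldl pushDigits s.1 := by
  induction l generalizing s with
  | nil => rfl
  | cons y l ih =>
    rw [digitPairs, List.foldl_cons, ← digitPairs, ih, List.foldl_cons]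
    simp [pushDigits, Nat.bit_bodd_div2]

theorem digitPairs_fst {γ : Type} (l : List γ) (s : (ℕ × ℕ) × List (Bool × Bool)) :
    (digitPairs l s).1 = (s.1.1 / 2 ^ l.length, s.1.2 / 2 ^ l.length) := by
  induction l generalizing s with
  | nil => simp [digitPairs]
  | cons y l ih =>
    rw [digitPairs, List.foldl_cons, ← digitPairs, ih]
    simp [Nat.div2_val, Nat.div_div_eq_div_mul, pow_succ, mul_comm]

/-- The pairs of the binary digits of `a` and `b`, most significant digits first. -/
def binaryDigits (a b : ℕ) : List (Bool × Bool) :=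
  (digitPairs b.bits (digitPairs a.bits ((a, b), []))).2

theorem foldl_pushDigits_binaryDigits (a b : ℕ) :
    (binaryDigits a b).foldl pushDigits (0, 0) = (a, b) := by
  have h := (foldl_pushDigits_digitPairs b.bits (digitPairs a.bits ((a, b), []))).trans
    (foldl_pushDigits_digitPairs a.bits ((a, b), []))
  have ha : a / 2 ^ a.size = 0 := Nat.div_eq_of_lt (Nat.lt_size_self a)
  have hb : b / 2 ^ a.size / 2 ^ b.size = 0 :=
    Nat.div_eq_of_lt ((Nat.div_le_self _ _).trans_lt (Nat.lt_size_self b))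
  rw [digitPairs_fst, digitPairs_fst, Nat.size_eq_bits_len,
    Nat.size_eq_bits_len] at h
  simpa [ha, hb, binaryDigits] using h

/-- One digit of an addition, most significant digits first. The accumulator holds the sum `n` of
the numbers read so far and also `n + 1`, in place of a carry that is not known yet. -/
def addStep (n : ℕ × ℕ) (d : Bool × Bool) : ℕ × ℕ :=
  bif d.1 then
    bif d.2 then (Nat.bit false n.2, Nat.bit true n.2) else (Nat.bit true n.1, Nat.bit false n.2)
  else
    bif d.2 then (Nat.bit true n.1, Nat.bit false n.2) else (Nat.bit false n.1, Nat.bit true n.1)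

theorem foldl_addStep (l : List (Bool × Bool)) (n : ℕ × ℕ) :
    l.foldl addStep (n.1 + n.2, n.1 + n.2 + 1) = ((l.foldl pushDigits n).1 +
      (l.foldl pushDigits n).2, (l.foldl pushDigits n).1 + (l.foldl pushDigits n).2 + 1) := by
  induction l generalizing n with
  | nil => rfl
  | cons d l ih =>
    rw [List.foldl_cons, List.foldl_cons, ← ih]
    congr 1
    rcases d with ⟨_ | _, _ | _⟩ <;>
      simp only [addStep, pushDigits, Nat.bit_val, cond_true, cond_false, Bool.toNat_false,
        Bool.toNat_true, Prod.mk.injEq] <;>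
      omega

theorem encSize_foldl_addStep_le (l : List (Bool × Bool)) (n : ℕ × ℕ) {M : ℕ}
    (h1 : encSize n.1 ≤ M) (h2 : encSize n.2 ≤ M) :
    encSize (l.foldl addStep n) ≤ 2 * (M + 2 * l.length) := by
  induction l generalizing n M with
  | nil =>
    rw [List.foldl_nil, show encSize n = encSize n.1 + encSize n.2 from rfl]
    simp only [List.length_nil]
    omega
  | cons d l ih =>
    have key : ∀ b, encSize (Nat.bit b n.1) ≤ M + 2 ∧ encSize (Nat.bit b n.2) ≤ M + 2 :=
      fun b => ⟨(encSize_bit_le b n.1).trans (by omega), (encSize_bit_le b n.2).trans (by omega)⟩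
    refine (ih (addStep n d) (M := M + 2) ?_ ?_).trans
      (by simp only [List.length_cons]; omega) <;>
    · rcases d with ⟨_ | _, _ | _⟩ <;> simp only [addStep, cond_true, cond_false, key]

/-- One digit of a comparison, most significant digits first. The accumulator `c` tells whether
`a < b` and whether `a ≤ b` for the numbers `a` and `b` read so far. -/
def ltStep (c : Bool × Bool) (d : Bool × Bool) : Bool × Bool :=
  bif d.1 then bif d.2 then c else (c.1, c.1) else bif d.2 then (c.2, c.2) else c

theorem foldl_ltStep (l : List (Bool × Bool)) (n : ℕ × ℕ) :
    l.foldl ltStep (decide (n.1 < n.2), decide (n.1 ≤ n.2)) =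
      (decide ((l.foldl pushDigits n).1 < (l.foldl pushDigits n).2),
        decide ((l.foldl pushDigits n).1 ≤ (l.foldl pushDigits n).2)) := by
  induction l generalizing n with
  | nil => rfl
  | cons d l ih =>
    rw [List.foldl_cons, List.foldl_cons, ← ih]
    congr 1
    rcases d with ⟨_ | _, _ | _⟩ <;>
      simp only [ltStep, pushDigits, Nat.bit_val, cond_true, cond_false, Bool.toNat_false,
        Bool.toNat_true, Prod.mk.injEq, decide_eq_decide] <;>
      omega

namespace PolyTime

theorem bits {f : α → ℕ} (hf : PolyTime f) : PolyTime fun x => (f x).bits :=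
  hf.congr_enc _ _ (fun _ => rfl) fun _ => rfl

theorem bodd {f : α → ℕ} (hf : PolyTime f) : PolyTime fun x => (f x).bodd := by
  refine (list_headD hf.bits (const false)).congr_enc _ _ (fun _ => rfl) fun x => ?_
  rw [Nat.bodd_eq_bits_head]
  cases (f x).bits <;> rfl

theorem div2 {f : α → ℕ} (hf : PolyTime f) : PolyTime fun x => (f x).div2 := by
  refine (list_tail hf.bits).congr_enc _ _ (fun _ => rfl) fun x => ?_
  rw [enc_nat, Nat.div2_bits_eq_tail]

theorem bit {b : α → Bool} {f : α → ℕ} (hb : PolyTime b) (hf : PolyTime f) :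
    PolyTime fun x => Nat.bit (b x) (f x) := by
  have h := hb.cond ((const true).cons hf.bits) (list_cases (f := fun _ => [])
    (g := fun q => false :: q.2.1 :: q.2.2) hf.bits nil
    ((const false).cons ((fst.comp snd).cons (snd.comp snd))))
  refine h.congr_enc _ _ (fun _ => rfl) fun x => ?_
  rw [enc_nat]
  congr 1
  by_cases hx : f x = 0
  · cases b x <;> simp [hx]
  · rw [Nat.bits_append_bit _ _ fun h => absurd h hx]
    cases b x
    · have h : (f x).bits ≠ [] := fun h => hx (by
        have := congrArg List.length h
        rwa [Nat.size_eq_bits_len, List.length_nil, Nat.size_eq_zero] at this)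
      cases hl : (f x).bits with
      | nil => exact absurd hl h
      | cons c t => rfl
    · rfl

theorem digitPairs {l : α → List β} {s : α → (ℕ × ℕ) × List (Bool × Bool)} (hl : PolyTime l)
    (hs : PolyTime s) : PolyTime fun x => digitPairs (l x) (s x) := by
  refine hl.foldl_of_add_le (B := fun _ => 4) hs ?_ (.const 4) ?_
  · have h : PolyTime fun p : α × (((ℕ × ℕ) × List (Bool × Bool)) × β) => p.2.1.1 :=
      fst.comp (fst.comp snd)
    exact ((fst.comp h).div2.pair (snd.comp h).div2).pair
      (((fst.comp h).bodd.pair (snd.comp h).bodd).cons (snd.comp (fst.comp snd)))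
  · rintro x y - ⟨⟨a, b⟩, t⟩
    have h1 := encSize_div2_le a
    have h2 := encSize_div2_le b
    have h3 := encSize_bool_le a.bodd
    have h4 := encSize_bool_le b.bodd
    simp only [encSize_pair, encSize_cons]
    omega

theorem binaryDigits {f g : α → ℕ} (hf : PolyTime f) (hg : PolyTime g) :
    PolyTime fun x => binaryDigits (f x) (g x) :=
  snd.comp (digitPairs hg.bits (digitPairs hf.bits ((hf.pair hg).pair nil)))

theorem add {f g : α → ℕ} (hf : PolyTime f) (hg : PolyTime g) :
    PolyTime fun x => f x + g x := by
  have h1 : PolyTime fun p : α × ((ℕ × ℕ) × (Bool × Bool)) => p.2.1.1 := fst.comp (fst.comp snd)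
  have h2 : PolyTime fun p : α × ((ℕ × ℕ) × (Bool × Bool)) => p.2.1.2 := snd.comp (fst.comp snd)
  have h3 : PolyTime fun p : α × ((ℕ × ℕ) × (Bool × Bool)) => addStep p.2.1 p.2.2 := by
    have hd1 : PolyTime fun p : α × ((ℕ × ℕ) × (Bool × Bool)) => p.2.2.1 :=
      fst.comp (snd.comp snd)
    have hd2 : PolyTime fun p : α × ((ℕ × ℕ) × (Bool × Bool)) => p.2.2.2 :=
      snd.comp (snd.comp snd)
    have e1 := ((const true).bit h1).pair ((const false).bit h2)
    exact hd1.cond (hd2.cond (((const false).bit h2).pair ((const true).bit h2)) e1)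
      (hd2.cond e1 (((const false).bit h1).pair ((const true).bit h1)))
  have h4 : PolyTime fun x => (_root_.binaryDigits (f x) (g x)).foldl addStep (0, 1) := by
    refine (hf.binaryDigits hg).foldl (const (0, 1)) h3
      (B := fun x => 2 * (3 + 2 * encSize (_root_.binaryDigits (f x) (g x))))
      ((PolyBounded.const 2).mul ((PolyBounded.const 3).add
        ((PolyBounded.const 2).mul (hf.binaryDigits hg).polyBounded))) fun x k => ?_
    have h5 := encSize_foldl_addStep_le ((_root_.binaryDigits (f x) (g x)).take k) (0, 1)
      (M := 3) (by decide) (by decide)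
    have h6 : ((_root_.binaryDigits (f x) (g x)).take k).length ≤ _ :=
      (List.length_take_le' _ _).trans (length_lt_encSize _).le
    omega
  refine (fst.comp h4).congr_enc _ _ (fun _ => rfl) fun x => ?_
  have h5 := foldl_addStep (_root_.binaryDigits (f x) (g x)) (0, 0)
  rw [foldl_pushDigits_binaryDigits] at h5
  exact congrArg (fun n : ℕ × ℕ => enc n.1) h5

theorem lt {f g : α → ℕ} (hf : PolyTime f) (hg : PolyTime g) :
    PolyTime fun x => decide (f x < g x) := by
  have h3 : PolyTime fun p : α × ((Bool × Bool) × (Bool × Bool)) => ltStep p.2.1 p.2.2 := by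
    have h1 : PolyTime fun p : α × ((Bool × Bool) × (Bool × Bool)) => p.2.1 := fst.comp snd
    have hd1 : PolyTime fun p : α × ((Bool × Bool) × (Bool × Bool)) => p.2.2.1 :=
      fst.comp (snd.comp snd)
    have hd2 : PolyTime fun p : α × ((Bool × Bool) × (Bool × Bool)) => p.2.2.2 :=
      snd.comp (snd.comp snd)
    exact hd1.cond (hd2.cond h1 ((fst.comp h1).pair (fst.comp h1)))
      (hd2.cond ((snd.comp h1).pair (snd.comp h1)) h1)
  have h4 : PolyTime fun x => (_root_.binaryDigits (f x) (g x)).foldl ltStep (false, true) := by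
    refine (hf.binaryDigits hg).foldl (const (false, true)) h3 (PolyBounded.const 4)
      fun x k => ?_
    generalize List.foldl ltStep _ _ = c
    have h5 := encSize_bool_le c.1
    have h6 := encSize_bool_le c.2
    have h7 : encSize c = encSize c.1 + encSize c.2 := rfl
    omega
  refine (fst.comp h4).congr_enc _ _ (fun _ => rfl) fun x => ?_
  have h5 := foldl_ltStep (_root_.binaryDigits (f x) (g x)) (0, 0)
  rw [foldl_pushDigits_binaryDigits] at h5
  exact congrArg (fun c : Bool × Bool => enc c.1) h5

theorem eq_nat {f g : α → ℕ} (hf : PolyTime f) (hg : PolyTime g) :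
    PolyTime fun x => decide (f x = g x) := by
  refine ((hf.lt hg).cond (const false) ((hg.lt hf).cond (const false) (const true))).congr_enc
    _ _ (fun _ => rfl) fun x => ?_
  congr 1
  rcases lt_trichotomy (f x) (g x) with h | h | h
  · simp [h, h.ne]
  · simp [h]
  · simp [h, h.ne', h.not_gt]

end PolyTime

end Arithmetic

/-! ### Arithmetic of exponents -/

section Cost

open DataEncoding

variable {α : Type} [DataEncoding α]

/-- The comparison of exponents, where `none` stands for `∞`. -/
def Option.costLT : Option ℕ → Option ℕ → Bool
  | none, _ => false
  | some _, none => true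
  | some i, some j => decide (i < j)

/-- The minimum of two exponents, where `none` stands for `∞`. -/
def Option.costMin (a b : Option ℕ) : Option ℕ := bif a.costLT b then a else b

/-- The sum of two exponents, where `none` stands for `∞`. -/
def Option.costAdd : Option ℕ → Option ℕ → Option ℕ
  | some i, some j => some (i + j)
  | _, _ => none

namespace PolyTime

theorem some {f : α → ℕ} (hf : PolyTime f) : PolyTime fun x => some (f x) :=
  ((const ()).pair hf).congr_enc _ _ (fun _ => rfl) fun _ => rfl

theorem getD {f : α → Option ℕ} (hf : PolyTime f) : PolyTime fun x => (f x).getD 0 :=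
  (tail.congr_enc enc (fun o : Option ℕ => o.getD 0) (fun _ => rfl)
    (fun o => by cases o <;> rfl)).comp hf

theorem isSome {f : α → Option ℕ} (hf : PolyTime f) : PolyTime fun x => (f x).isSome :=
  ite_enc hf (const true) (const false)
    (fun x h => by cases hx : f x <;> simp_all) (fun x h => by cases hx : f x <;> simp_all)

theorem costLT {f g : α → Option ℕ} (hf : PolyTime f) (hg : PolyTime g) :
    PolyTime fun x => (f x).costLT (g x) := by
  refine (hf.isSome.cond (hg.isSome.cond (hf.getD.lt hg.getD) (const true))
    (const false)).congr_enc _ _ (fun _ => rfl) fun x => ?_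
  cases f x <;> cases g x <;> rfl

theorem costMin {f g : α → Option ℕ} (hf : PolyTime f) (hg : PolyTime g) :
    PolyTime fun x => (f x).costMin (g x) :=
  (hf.costLT hg).cond hf hg

theorem costAdd {f g : α → Option ℕ} (hf : PolyTime f) (hg : PolyTime g) :
    PolyTime fun x => (f x).costAdd (g x) := by
  refine (hf.isSome.cond (hg.isSome.cond (hf.getD.add hg.getD).some (const none))
    (const none)).congr_enc _ _ (fun _ => rfl) fun x => ?_
  cases f x <;> cases g x <;> rfl

end PolyTime

end Cost

/-! ### State elimination on exponents -/

/-- The exponents of the rates at which a state is left, where `none` stands for the rate `0`: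
first the exponent for the losing sink, then the list of the exponents for the states that are not
yet eliminated, followed by the one for the target. -/
abbrev CostRow : Type := Option ℕ × List (Option ℕ)

namespace CostRow

/-- The exponent of the total rate at which the first state of the list, which has the row `v`, is
left for something else. -/
def exit (v : CostRow) : Option ℕ := v.2.tail.foldl Option.costMin v.1

/-- `exit`, where a state that cannot be left gets an additional transition to the losing sink. -/
def exitCost (v : CostRow) : Option ℕ := bif v.exit.isSome then v.exit else some 0

/-- The exponent for the losing sink, where a state that cannot be left gets an additional
transition to that sink. -/
def sinkCost (v : CostRow) : Option ℕ := bif v.exit.isSome then v.1 else some 0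

/-- The row `r` after the elimination of the first state of the list, which has the row `v`. The
rates `r` are multiplied by the exit rate of `v`, so that no division is needed. -/
def elim (v r : CostRow) : CostRow :=
  ((r.1.costAdd v.exitCost).costMin ((r.2.headD none).costAdd v.sinkCost),
    List.zipWith (fun x y => (x.costAdd v.exitCost).costMin ((r.2.headD none).costAdd y))
      r.2.tail v.2.tail)

/-- The elimination of the first state from a list of rows and a further row, which belongs to the
starting point. -/
def elimFirst (s : List CostRow × CostRow) : List CostRow × CostRow :=
  match s.1 with
  | [] => s
  | v :: l => (l.map (elim v), elim v s.2)

end CostRow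

/-- Among the exponents in `V`, one list for every action, the smallest one for every successor. -/
def minCosts (base : List (Option ℕ)) (V : List (List (Option ℕ))) : List (Option ℕ) :=
  V.foldl (List.zipWith Option.costMin) base

/-- The exponents of the transition rates of a state, given its transition probabilities `δ` and
the ranks `ρ` of the actions. -/
def transCosts (base : List (Option ℕ)) (δ : List (List ℚ≥0)) (ρ : List (Option ℕ)) :
    List (Option ℕ) :=
  minCosts base (List.zipWith (fun l o => l.map fun q => bif decide (q ≠ 0) then o else none) δ ρ)

/-- The row of the state `i`. The last column belongs to an absorbing copy of the target, which is
the only successor of the target itself. -/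
def initialRow (t : ℕ) (base : List (Option ℕ)) (ρ : List (Option ℕ)) (i : ℕ)
    (δ : List (List ℚ≥0)) : CostRow :=
  bif decide (i = t) then (none, base ++ [some 0]) else (none, transCosts base δ ρ ++ [none])

/-- The rows of all states. -/
def initialRows (δ : List (List (List ℚ≥0))) (t : ℕ) (ρ : List (Option ℕ)) : List CostRow :=
  List.zipWith (initialRow t (δ.map fun _ => none) ρ) (List.range δ.length) δ

/-- The row of the starting point, which is left for the state `s`. -/
def startRow (n s : ℕ) : CostRow :=
  (none, (List.range n).map (fun i => bif decide (i = s) then some 0 else none) ++ [none])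

/-- The algorithm: eliminate all states, and compare the exponents of the two rates that are left,
those for the target and for the losing sink. -/
def verifier (δ : List (List (List ℚ≥0))) (s t : ℕ) (ρ : List (Option ℕ)) : Bool :=
  let r := (δ.foldl (fun x _ => CostRow.elimFirst x) (initialRows δ t ρ, startRow δ.length s)).2
  (r.2.headD none).costLT r.1

/-! ### The running time of state elimination -/

section ElimTime

open DataEncoding

variable {α β : Type} [DataEncoding α] [DataEncoding β]

/-- The finite ones among the exponents are smaller than `2 ^ k`. -/
def Option.BitsLE (k : ℕ) (o : Option ℕ) : Prop := ∀ i ∈ o, i < 2 ^ k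

theorem Option.BitsLE.encSize_le {k : ℕ} {o : Option ℕ} (h : o.BitsLE k) :
    encSize o ≤ 2 * k + 2 := by
  cases o with
  | none => simp
  | some i =>
    have := encSize_nat_le_of_lt (h i rfl)
    rw [encSize_some]
    omega

theorem Option.bitsLE_of_encSize_le {k : ℕ} {o : Option ℕ} (h : encSize o ≤ k) : o.BitsLE k := by
  intro i hi
  obtain rfl : o = some i := hi
  rw [encSize_some] at h
  exact (lt_two_pow_encSize i).trans_le (Nat.pow_le_pow_right (by norm_num) (by omega))

theorem Option.BitsLE.costMin {k : ℕ} {a b : Option ℕ} (ha : a.BitsLE k) (hb : b.BitsLE k) :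
    (a.costMin b).BitsLE k := by
  unfold Option.costMin
  cases a.costLT b
  exacts [hb, ha]

theorem Option.BitsLE.costAdd {k : ℕ} {a b : Option ℕ} (ha : a.BitsLE k) (hb : b.BitsLE k) :
    (a.costAdd b).BitsLE (k + 1) := by
  cases a with
  | none => simp [Option.costAdd, Option.BitsLE]
  | some i =>
    cases b with
    | none => simp [Option.costAdd, Option.BitsLE]
    | some j =>
      have h1 := ha i rfl
      have h2 := hb j rfl
      simp only [Option.costAdd, Option.BitsLE, Option.mem_def, Option.some.injEq, forall_eq']
      rw [pow_succ]
      omega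

theorem Option.bitsLE_zero (k : ℕ) : (some 0 : Option ℕ).BitsLE k := by
  simp [Option.BitsLE]

namespace CostRow

/-- The row has at most `L` entries apart from the first one, of at most `k` bits each. -/
def Bounded (L k : ℕ) (r : CostRow) : Prop :=
  r.2.length ≤ L ∧ r.1.BitsLE k ∧ ∀ x ∈ r.2, x.BitsLE k

theorem Bounded.encSize_le {L k : ℕ} {r : CostRow} (h : r.Bounded L k) :
    encSize r ≤ (L + 1) * (2 * k + 2) + 1 := by
  have h1 := h.2.1.encSize_le
  have h2 := encSize_list_le fun x hx => (h.2.2 x hx).encSize_le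
  have h3 := Nat.mul_le_mul_right (2 * k + 2) h.1
  rw [show encSize r = encSize r.1 + encSize r.2 from rfl]
  linarith

theorem bounded_of_encSize_le {k : ℕ} {r : CostRow} (h : encSize r ≤ k) : r.Bounded k k := by
  rw [show encSize r = encSize r.1 + encSize r.2 from rfl] at h
  have h1 := length_lt_encSize r.2
  refine ⟨by omega, Option.bitsLE_of_encSize_le (by omega), fun x hx => ?_⟩
  have := encSize_le_of_mem hx
  exact Option.bitsLE_of_encSize_le (by omega)

theorem Bounded.exit {L k : ℕ} {v : CostRow} (h : v.Bounded L k) : v.exit.BitsLE k := by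
  have key : ∀ (l : List (Option ℕ)) (a : Option ℕ), a.BitsLE k → (∀ x ∈ l, x.BitsLE k) →
      (l.foldl Option.costMin a).BitsLE k := by
    intro l
    induction l with
    | nil => exact fun a ha _ => ha
    | cons x l ih =>
      exact fun a ha hl => ih _ (ha.costMin (hl x (by simp))) fun y hy => hl y (by simp [hy])
  exact key _ _ h.2.1 fun x hx => h.2.2 x (List.mem_of_mem_tail hx)

theorem Bounded.exitCost {L k : ℕ} {v : CostRow} (h : v.Bounded L k) : v.exitCost.BitsLE k := by
  unfold CostRow.exitCost
  cases v.exit.isSome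
  exacts [Option.bitsLE_zero k, h.exit]

theorem Bounded.sinkCost {L k : ℕ} {v : CostRow} (h : v.Bounded L k) : v.sinkCost.BitsLE k := by
  unfold CostRow.sinkCost
  cases v.exit.isSome
  exacts [Option.bitsLE_zero k, h.2.1]

theorem Bounded.elim {L k : ℕ} {v r : CostRow} (hv : v.Bounded L k) (hr : r.Bounded L k) :
    (v.elim r).Bounded L (k + 1) := by
  have h : (r.2.headD none).BitsLE k := by
    have := hr.2.2
    cases hl : r.2 with
    | nil => simp [Option.BitsLE]
    | cons x l => exact this x (by simp [hl])
  refine ⟨?_, (hr.2.1.costAdd hv.exitCost).costMin (h.costAdd hv.sinkCost), fun x hx => ?_⟩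
  · have := hr.1
    simp only [CostRow.elim, List.length_zipWith, List.length_tail]
    omega
  · simp only [CostRow.elim] at hx
    rw [List.mem_iff_getElem] at hx
    obtain ⟨i, hi, rfl⟩ := hx
    rw [List.getElem_zipWith]
    exact ((hr.2.2 _ (List.mem_of_mem_tail (List.getElem_mem _))).costAdd hv.exitCost).costMin
      (h.costAdd (hv.2.2 _ (List.mem_of_mem_tail (List.getElem_mem _))))

/-- All rows have at most `L` entries apart from the first one, of at most `k` bits each. -/
def StateBounded (R L k : ℕ) (s : List CostRow × CostRow) : Prop :=
  s.1.length ≤ R ∧ (∀ r ∈ s.1, r.Bounded L k) ∧ s.2.Bounded L k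

theorem Bounded.mono {L k k' : ℕ} {r : CostRow} (h : r.Bounded L k) (hk : k ≤ k') :
    r.Bounded L k' :=
  have h2 : 2 ^ k ≤ 2 ^ k' := Nat.pow_le_pow_right (by norm_num) hk
  ⟨h.1, fun i hi => (h.2.1 i hi).trans_le h2, fun x hx i hi => (h.2.2 x hx i hi).trans_le h2⟩

theorem StateBounded.elimFirst {R L k : ℕ} {s : List CostRow × CostRow}
    (h : StateBounded R L k s) : StateBounded R L (k + 1) (CostRow.elimFirst s) := by
  obtain ⟨l, r⟩ := s
  obtain ⟨h1, h2, h3⟩ := h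
  cases l with
  | nil => exact ⟨by simp [CostRow.elimFirst], by simp [CostRow.elimFirst], h3.mono (by omega)⟩
  | cons v l =>
    refine ⟨?_, fun r hr => ?_, (h2 v (by simp)).elim h3⟩
    · simp only [CostRow.elimFirst, List.length_map, List.length_cons] at h1 ⊢
      omega
    · simp only [CostRow.elimFirst, List.mem_map] at hr
      obtain ⟨a, ha, rfl⟩ := hr
      exact (h2 v (by simp)).elim (h2 a (by simp [ha]))

theorem StateBounded.encSize_le {R L k : ℕ} {s : List CostRow × CostRow}
    (h : StateBounded R L k s) : encSize s ≤ (R + 1) * ((L + 1) * (2 * k + 2) + 1) + 1 := by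
  obtain ⟨h1, h2, h3⟩ := h
  have h4 := encSize_list_le fun r hr => (h2 r hr).encSize_le
  have h5 := h3.encSize_le
  have h6 := Nat.mul_le_mul_right ((L + 1) * (2 * k + 2) + 1) h1
  rw [show encSize s = encSize s.1 + encSize s.2 from rfl]
  linarith

theorem stateBounded_encSize (s : List CostRow × CostRow) :
    StateBounded (encSize s) (encSize s) (encSize s) s := by
  have h1 : encSize s = encSize s.1 + encSize s.2 := rfl
  have h2 := length_lt_encSize s.1
  refine ⟨by omega, fun r hr => ?_, bounded_of_encSize_le (by omega)⟩
  have := encSize_le_of_mem hr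
  exact bounded_of_encSize_le (by omega)

theorem StateBounded.foldl_elimFirst {γ : Type} {R L k : ℕ} (l : List γ)
    {s : List CostRow × CostRow} (h : StateBounded R L k s) :
    StateBounded R L (k + l.length) (l.foldl (fun x _ => CostRow.elimFirst x) s) := by
  induction l generalizing k s with
  | nil => exact h
  | cons y l ih =>
    rw [List.length_cons, ← add_assoc, add_right_comm]
    exact ih h.elimFirst

end CostRow

namespace PolyTime

theorem append_singleton {l : α → List β} {f : α → β} (hl : PolyTime l) (hf : PolyTime f) :
    PolyTime fun x => l x ++ [f x] := by
  refine (hf.cons hl.reverse).reverse.congr_enc _ _ (fun _ => rfl) fun x => ?_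
  simp

theorem foldl_costMin {l : α → List (Option ℕ)} {a : α → Option ℕ} (hl : PolyTime l)
    (ha : PolyTime a) : PolyTime fun x => (l x).foldl Option.costMin (a x) := by
  refine hl.foldl_of_add_le (B := fun x => encSize (l x)) ha
    (PolyTime.costMin (fst.comp snd) (snd.comp snd)) hl.polyBounded fun x y hy g => ?_
  have := encSize_le_of_mem hy
  unfold Option.costMin
  cases g.costLT y <;> simp only [cond_true, cond_false] <;> omega

theorem exit {v : α → CostRow} (hv : PolyTime v) : PolyTime fun x => (v x).exit :=
  foldl_costMin (snd.comp hv).list_tail (fst.comp hv)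

theorem elim {v r : α → CostRow} (hv : PolyTime v) (hr : PolyTime r) :
    PolyTime fun x => (v x).elim (r x) := by
  have hm : PolyTime fun x => (v x).exitCost := (exit hv).isSome.cond (exit hv) (const _)
  have hd : PolyTime fun x => (v x).sinkCost := (exit hv).isSome.cond (fst.comp hv) (const _)
  have ha : PolyTime fun x => (r x).2.headD none := list_headD (snd.comp hr) (const none)
  exact (((fst.comp hr).costAdd hm).costMin (ha.costAdd hd)).pair
    (zipWith (snd.comp hr).list_tail (snd.comp hv).list_tail
      (((fst.comp snd).costAdd (hm.comp fst)).costMin ((ha.comp fst).costAdd (snd.comp snd))))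

theorem elimFirst {s : α → List CostRow × CostRow} (hs : PolyTime s) :
    PolyTime fun x => CostRow.elimFirst (s x) := by
  refine (list_cases (l := fun x => (s x).1) (g := fun q =>
    (q.2.2.map (CostRow.elim q.2.1), CostRow.elim q.2.1 (s q.1).2)) (fst.comp hs) hs
    ((map (snd.comp snd) (elim (fst.comp (snd.comp fst)) snd)).pair
      (elim (fst.comp snd) ((snd.comp hs).comp fst)))).congr_enc _ _ (fun _ => rfl) fun x => ?_
  unfold CostRow.elimFirst
  cases (s x).1 <;> rfl

theorem foldl_elimFirst {l : α → List β} {s : α → List CostRow × CostRow} (hl : PolyTime l)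
    (hs : PolyTime s) : PolyTime fun x => (l x).foldl (fun y _ => CostRow.elimFirst y) (s x) := by
  have h1 := hs.polyBounded
  have h2 := h1.add (.const 1)
  refine hl.foldl hs (elimFirst (fst.comp snd)) (B := fun x => (encSize (s x) + 1) *
    ((encSize (s x) + 1) * (2 * (encSize (s x) + encSize (l x)) + 2) + 1) + 1)
    ((h2.mul ((h2.mul (((PolyBounded.const 2).mul (h1.add hl.polyBounded)).add
      (.const 2))).add (.const 1))).add (.const 1)) fun x k => ?_
  refine ((CostRow.stateBounded_encSize (s x)).foldl_elimFirst ((l x).take k)).encSize_le.trans ?_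
  have : ((l x).take k).length ≤ encSize (l x) :=
    (List.length_take_le' _ _).trans (length_lt_encSize _).le
  gcongr

theorem minCosts {b : α → List (Option ℕ)} {V : α → List (List (Option ℕ))} (hb : PolyTime b)
    (hV : PolyTime V) : PolyTime fun x => minCosts (b x) (V x) := by
  refine hV.foldl_of_add_le (B := fun x => encSize (V x)) hb
    (zipWith (fst.comp snd) (snd.comp snd)
      (PolyTime.costMin (fst.comp snd) (snd.comp snd))) hV.polyBounded
    fun x y hy g => ?_
  refine le_trans ?_ (Nat.add_le_add_left (encSize_le_of_mem hy) _)
  clear hy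
  induction g generalizing y with
  | nil => simp
  | cons a g ih =>
    cases y with
    | nil => simp
    | cons c y =>
      have h1 := ih y
      simp only [List.zipWith_cons_cons, encSize_cons]
      unfold Option.costMin at h1 ⊢
      cases a.costLT c <;> simp only [cond_true, cond_false] <;> omega

theorem ne_zero {q : α → ℚ≥0} (hq : PolyTime q) : PolyTime fun x => decide (q x ≠ 0) := by
  have h : PolyTime fun q : ℚ≥0 => q.num :=
    head.congr_enc enc (fun q : ℚ≥0 => q.num) (fun _ => rfl) fun _ => rfl
  have key : ∀ x, enc (q x).num = .nil ↔ q x = 0 := by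
    intro x
    rw [← not_iff_not.1 (NNRat.num_ne_zero (q := q x))]
    constructor
    · intro h
      rw [enc_nat] at h
      have h2 : (q x).num.bits = [] := by
        cases hl : (q x).num.bits with
        | nil => rfl
        | cons a t => simp [hl] at h
      rw [← Nat.size_eq_zero, ← Nat.size_eq_bits_len, h2, List.length_nil]
    · intro h
      rw [h]
      rfl
  refine ite_enc (h.comp hq) (const true) (const false) (fun x hx => ?_) (fun x hx => ?_)
  · simpa using (key x).not.1 hx
  · simpa using (key x).1 hx

theorem transCosts {b : α → List (Option ℕ)} {δ : α → List (List ℚ≥0)} {ρ : α → List (Option ℕ)}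
    (hb : PolyTime b) (hδ : PolyTime δ) (hρ : PolyTime ρ) :
    PolyTime fun x => transCosts (b x) (δ x) (ρ x) :=
  minCosts hb (zipWith hδ hρ (map (fst.comp snd)
    (snd.ne_zero.cond (snd.comp (snd.comp fst)) (const none))))

theorem range_length {l : α → List β} (hl : PolyTime l) :
    PolyTime fun x => List.range (l x).length := by
  have key : ∀ l : List β, l.foldl (fun (s : ℕ × List ℕ) _ => (s.1 + 1, s.1 :: s.2)) (0, []) =
      (l.length, (List.range l.length).reverse) := by
    intro l
    induction l using List.reverseRecOn with
    | nil => rfl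
    | append_singleton l y ih => simp [ih, List.range_succ]
  have h : PolyTime fun x => (l x).foldl (fun (s : ℕ × List ℕ) _ => (s.1 + 1, s.1 :: s.2))
      (0, []) := by
    have hs : PolyTime fun p : α × ((ℕ × List ℕ) × β) => p.2.1.1 := fst.comp (fst.comp snd)
    have hL := hl.polyBounded
    have h2 := ((PolyBounded.const 2).mul hL).add (.const 1)
    refine hl.foldl (B := fun x => (2 * encSize (l x) + 1) +
      (encSize (l x) * (2 * encSize (l x) + 1) + 1)) (const (0, []))
      ((hs.add (const 1)).pair (hs.cons (snd.comp (fst.comp snd))))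
      (h2.add ((hL.mul h2).add (.const 1))) fun x k => ?_
    have h3 : ((l x).take k).length ≤ encSize (l x) :=
      (List.length_take_le' _ _).trans (length_lt_encSize _).le
    have h4 : ∀ i ≤ encSize (l x), encSize i ≤ 2 * encSize (l x) + 1 := fun i hi =>
      (encSize_nat_le_of_lt i.lt_two_pow_self).trans (by omega)
    rw [key, encSize_pair, encSize_reverse]
    refine add_le_add (h4 _ h3) ?_
    refine (encSize_list_le (B := 2 * encSize (l x) + 1) fun i hi => h4 i ?_).trans ?_
    · rw [List.mem_range] at hi
      omega
    · rw [List.length_range]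
      gcongr
  refine (snd.comp h).reverse.congr_enc _ _ (fun _ => rfl) fun x => ?_
  rw [key, List.reverse_reverse]

theorem initialRow {t i : α → ℕ} {b ρ : α → List (Option ℕ)} {δ : α → List (List ℚ≥0)}
    (ht : PolyTime t) (hb : PolyTime b) (hρ : PolyTime ρ) (hi : PolyTime i) (hδ : PolyTime δ) :
    PolyTime fun x => initialRow (t x) (b x) (ρ x) (i x) (δ x) :=
  (hi.eq_nat ht).cond ((const none).pair (hb.append_singleton (const (Option.some 0))))
    ((const none).pair ((transCosts hb hδ hρ).append_singleton (const none)))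

theorem initialRows {t : α → ℕ} {ρ : α → List (Option ℕ)} {δ : α → List (List (List ℚ≥0))}
    (hδ : PolyTime δ) (ht : PolyTime t) (hρ : PolyTime ρ) :
    PolyTime fun x => initialRows (δ x) (t x) (ρ x) :=
  zipWith hδ.range_length hδ (initialRow (ht.comp fst)
    ((map (F := fun _ _ => none) hδ (const none)).comp fst) (hρ.comp fst) (fst.comp snd)
    (snd.comp snd))

theorem startRow {s : α → ℕ} {l : α → List β} (hl : PolyTime l) (hs : PolyTime s) :
    PolyTime fun x => startRow (l x).length (s x) :=
  (const none).pair ((map hl.range_length ((snd.eq_nat (hs.comp fst)).cond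
    (const (Option.some 0)) (const none))).append_singleton (const none))

theorem verifier {s t : α → ℕ} {ρ : α → List (Option ℕ)} {δ : α → List (List (List ℚ≥0))}
    (hδ : PolyTime δ) (hs : PolyTime s) (ht : PolyTime t) (hρ : PolyTime ρ) :
    PolyTime fun x => verifier (δ x) (s x) (t x) (ρ x) := by
  have h := snd.comp (foldl_elimFirst hδ ((initialRows hδ ht hρ).pair (startRow hδ hs)))
  exact (list_headD (snd.comp h) (const none)).costLT (fst.comp h)

end PolyTime

end ElimTime

namespace VerifierInput

/-- The table of the transition probabilities. -/
def table (I : VerifierInput) : List (List (List ℚ≥0)) :=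
  List.ofFn fun s => List.ofFn fun a => List.ofFn fun s' => I.mdp.δ s a s'

/-- The list of the ranks. -/
def ranks (I : VerifierInput) : List (Option ℕ) := List.ofFn I.policy.rank

instance : DataEncoding VerifierInput := ⟨encode⟩

theorem encode_eq (I : VerifierInput) : I.encode =
    DataEncoding.enc (I.table, ((I.mdp.s₀ : ℕ), ((I.target : ℕ), (I.ranks, ())))) := by
  simp only [encode, table, ranks, DataEncoding.enc, Data.ofList, List.map_ofFn,
    Function.comp_def]

theorem polyTime_verifier : PolyTime fun I : VerifierInput =>
    verifier I.table I.mdp.s₀ I.target I.ranks := by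
  have h : PolyTime fun I : VerifierInput =>
      (I.table, ((I.mdp.s₀ : ℕ), ((I.target : ℕ), (I.ranks, ())))) :=
    PolyTime.self.congr_enc (fun I : VerifierInput =>
      (I.table, ((I.mdp.s₀ : ℕ), ((I.target : ℕ), (I.ranks, ()))))) _
      (fun I => I.encode_eq.symm) fun _ => rfl
  exact (PolyTime.fst.comp h).verifier (PolyTime.fst.comp (PolyTime.snd.comp h))
    (PolyTime.fst.comp (PolyTime.snd.comp (PolyTime.snd.comp h)))
    (PolyTime.fst.comp (PolyTime.snd.comp (PolyTime.snd.comp (PolyTime.snd.comp h))))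

end VerifierInput

theorem decidableInPolyTime_of_polyTime {α : Type} [DataEncoding α] {f : α → Bool} {P : α → Prop}
    (hf : PolyTime f) (hP : ∀ x, f x = true ↔ P x) :
    DecidableInPolyTime (DataEncoding.enc : α → Data) P := by
  obtain ⟨Q, b, ⟨p, hp⟩, h⟩ := hf
  refine ⟨Q, p, fun x => ?_⟩
  obtain ⟨t, ht, htb⟩ := h x
  refine ⟨_, t, ht, htb.trans (hp x), ?_⟩
  rw [← hP]
  cases f x <;> simp

/-! ### State elimination on rates -/

/-- The rates at which a state is left: first the rate for the losing sink, then the list of the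
rates for the states that are not yet eliminated, followed by the one for the target. -/
abbrev RateRow : Type := ℝ × List ℝ

/-- The sum of the products of the corresponding entries. -/
def List.dot (l h : List ℝ) : ℝ := (List.zipWith (· * ·) l h).sum

@[simp] theorem List.dot_nil_left (h : List ℝ) : List.dot [] h = 0 := by simp [List.dot]

@[simp] theorem List.dot_cons (a b : ℝ) (l h : List ℝ) :
    List.dot (a :: l) (b :: h) = a * b + List.dot l h := by simp [List.dot]

theorem List.dot_nonneg {l h : List ℝ} (hl : ∀ x ∈ l, 0 ≤ x) (hh : ∀ x ∈ h, 0 ≤ x) :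
    0 ≤ List.dot l h := by
  induction l generalizing h with
  | nil => simp
  | cons a l ih =>
    cases h with
    | nil => simp [List.dot]
    | cons b h =>
      rw [List.dot_cons]
      have h1 := ih (h := h) (fun x hx => hl x (by simp [hx])) (fun x hx => hh x (by simp [hx]))
      have h2 := mul_nonneg (hl a (by simp)) (hh b (by simp))
      linarith

theorem List.dot_eq_zero {l : List ℝ} (hl : ∀ x ∈ l, 0 ≤ x) (h0 : l.sum = 0) (h : List ℝ) :
    List.dot l h = 0 := by
  induction l generalizing h with
  | nil => simp
  | cons a l ih =>
    have h1 := hl a (by simp)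
    have h2 : 0 ≤ l.sum := List.sum_nonneg fun x hx => hl x (by simp [hx])
    rw [List.sum_cons] at h0
    cases h with
    | nil => simp [List.dot]
    | cons b h =>
      rw [List.dot_cons, ih (fun x hx => hl x (by simp [hx])) (by linarith),
        show a = 0 by linarith]
      simp

theorem List.sum_zipWith_linear {l l' : List ℝ} (m a : ℝ) (hl : l.length = l'.length) :
    (List.zipWith (fun x y => x * m + a * y) l l').sum = l.sum * m + a * l'.sum := by
  induction l generalizing l' with
  | nil => cases l' <;> simp at hl ⊢
  | cons x l ih =>
    cases l' with
    | nil => simp at hl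
    | cons y l' =>
      simp only [List.zipWith_cons_cons, List.sum_cons, ih (l' := l') (by simpa using hl)]
      ring

theorem List.dot_zipWith_linear {l l' h : List ℝ} (m a : ℝ) (hl : l.length = l'.length)
    (hh : l.length = h.length) :
    List.dot (List.zipWith (fun x y => x * m + a * y) l l') h =
      List.dot l h * m + a * List.dot l' h := by
  induction l generalizing l' h with
  | nil => cases l' <;> simp at hl ⊢
  | cons x l ih =>
    cases l' with
    | nil => simp at hl
    | cons y l' =>
      cases h with
      | nil => simp at hh
      | cons z h =>
        simp only [List.zipWith_cons_cons, List.dot_cons,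
          ih (l' := l') (h := h) (by simpa using hl) (by simpa using hh)]
        ring

namespace RateRow

/-- The value `x` of a state with the row `r` is at least the average of the values `h` that its
transitions lead to, the losing sink having the value `0`. A self-loop contributes the same amount
to both sides. -/
def Super (h : List ℝ) (r : RateRow) (x : ℝ) : Prop := List.dot r.2 h ≤ x * (r.1 + r.2.sum)

/-- The total rate at which the first state of the list, which has the row `v`, is left for
something else. -/
def exit (v : RateRow) : ℝ := v.1 + v.2.tail.sum

open Classical in
/-- `exit`, where a state that cannot be left gets an additional transition to the losing sink. -/
noncomputable def exitRate (v : RateRow) : ℝ := if v.exit = 0 then 1 else v.exit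

open Classical in
/-- The rate for the losing sink, where a state that cannot be left gets an additional transition
to that sink. -/
noncomputable def sinkRate (v : RateRow) : ℝ := if v.exit = 0 then 1 else v.1

/-- The row `r` after the elimination of the first state of the list, which has the row `v`. -/
noncomputable def elim (v r : RateRow) : RateRow :=
  (r.1 * v.exitRate + r.2.headD 0 * v.sinkRate,
    List.zipWith (fun x y => x * v.exitRate + r.2.headD 0 * y) r.2.tail v.2.tail)

/-- All rates are nonnegative. -/
def Nonneg (r : RateRow) : Prop := 0 ≤ r.1 ∧ ∀ x ∈ r.2, 0 ≤ x

/-- `y` is the value of the starting point, which has the row `r`, in some nonnegative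
supersolution of the equations for the probability of reaching the target. -/
def Feasible (l : List RateRow) (r : RateRow) (y : ℝ) : Prop :=
  ∃ xs : List ℝ, (∀ x ∈ xs, 0 ≤ x) ∧ List.Forall₂ (Super (xs ++ [1])) l xs ∧ 0 ≤ y ∧
    Super (xs ++ [1]) r y

theorem Nonneg.exit {v : RateRow} (hv : v.Nonneg) : 0 ≤ v.exit :=
  add_nonneg hv.1 (List.sum_nonneg fun x hx => hv.2 x (List.mem_of_mem_tail hx))

theorem Nonneg.exitRate_pos {v : RateRow} (hv : v.Nonneg) : 0 < v.exitRate := by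
  unfold exitRate
  split_ifs with h
  exacts [one_pos, lt_of_le_of_ne hv.exit (Ne.symm h)]

theorem Nonneg.tail_eq_zero {v : RateRow} (hv : v.Nonneg) (h : v.exit = 0) :
    v.1 = 0 ∧ v.2.tail.sum = 0 := by
  have h1 : 0 ≤ v.2.tail.sum := List.sum_nonneg fun x hx => hv.2 x (List.mem_of_mem_tail hx)
  have h2 := hv.1
  unfold RateRow.exit at h
  constructor <;> linarith

theorem Nonneg.sinkRate_add {v : RateRow} (hv : v.Nonneg) :
    v.sinkRate + v.2.tail.sum = v.exitRate := by
  unfold sinkRate exitRate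
  split_ifs with h
  · rw [(hv.tail_eq_zero h).2, add_zero]
  · rfl

theorem super_cons_self_iff {h : List ℝ} {v : RateRow} (hv : v.Nonneg) (h2 : v.2 ≠ []) {x : ℝ}
    (hx : 0 ≤ x) : Super (x :: h) v x ↔ List.dot v.2.tail h ≤ x * v.exitRate := by
  obtain ⟨d, _ | ⟨a, t⟩⟩ := v
  · simp at h2
  have h3 : Super (x :: h) (d, a :: t) x ↔ List.dot t h ≤ x * (RateRow.exit (d, a :: t)) := by
    unfold Super RateRow.exit
    simp only [List.dot_cons, List.sum_cons, List.tail_cons]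
    constructor <;> intro h <;> linarith
  rw [h3]
  unfold exitRate
  split_ifs with h4
  · have h5 := hv.tail_eq_zero h4
    have h6 := List.dot_eq_zero (l := t) (fun z hz => hv.2 z (List.mem_cons_of_mem a hz)) h5.2 h
    rw [h4, List.tail_cons, h6]
    simp [hx]
  · rfl

theorem super_elim_iff {h : List ℝ} {v r : RateRow} (hv : v.Nonneg) {x : ℝ}
    (hlen : v.2.length = r.2.length) (hh : r.2.length = h.length + 1) :
    Super h (v.elim r) x ↔ List.dot r.2.tail h * v.exitRate +
      r.2.headD 0 * List.dot v.2.tail h ≤ x * (r.1 + r.2.sum) * v.exitRate := by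
  have h1 : r.2.sum = r.2.headD 0 + r.2.tail.sum := by
    cases h : r.2 <;> simp
  have h2 : r.2.tail.length = v.2.tail.length := by simp [hlen]
  unfold Super elim
  simp only
  rw [List.dot_zipWith_linear _ _ h2 (by simp [hh]), List.sum_zipWith_linear _ _ h2, h1,
    ← hv.sinkRate_add]
  constructor <;> intro h <;> linarith

/-- Elimination of a state does not change the supersolutions on the other states. -/
theorem feasible_cons_iff {v r : RateRow} {l : List RateRow} {y : ℝ} (hv : v.Nonneg)
    (hl : ∀ u ∈ l, u.Nonneg) (hr : r.Nonneg) (hvlen : v.2.length = l.length + 2)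
    (hllen : ∀ u ∈ l, u.2.length = l.length + 2) (hrlen : r.2.length = l.length + 2) :
    Feasible (v :: l) r y ↔ Feasible (l.map v.elim) (v.elim r) y := by
  have hm := hv.exitRate_pos
  have hv2 : v.2 ≠ [] := by
    intro h
    simp [h] at hvlen
  have dot_eq : ∀ (u : RateRow) (x0 : ℝ) (h : List ℝ), u.2.length = l.length + 2 →
      List.dot u.2 (x0 :: h) = u.2.headD 0 * x0 + List.dot u.2.tail h := by
    intro u x0 h hu
    cases hl : u.2 with
    | nil => simp [hl] at hu
    | cons a t => simp
  have head_nonneg : ∀ u : RateRow, u.Nonneg → 0 ≤ u.2.headD 0 := by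
    rintro ⟨d, _ | ⟨a, t⟩⟩ hu
    · simp
    · exact hu.2 a (by simp)
  -- The two directions for a single row, given the value `x0` of the eliminated state.
  have down : ∀ (u : RateRow) (x0 x : ℝ) (h : List ℝ), u.Nonneg → u.2.length = l.length + 2 →
      h.length = l.length + 1 → List.dot v.2.tail h ≤ x0 * v.exitRate →
      Super (x0 :: h) u x → Super h (v.elim u) x := by
    intro u x0 x h hu hulen hh hx0 hs
    rw [super_elim_iff hv (by omega) (by omega)]
    unfold Super at hs
    rw [dot_eq u x0 h hulen] at hs
    have h1 := mul_le_mul_of_nonneg_left hx0 (head_nonneg u hu)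
    have h2 := mul_le_mul_of_nonneg_right hs hm.le
    linarith
  have up : ∀ (u : RateRow) (x0 x : ℝ) (h : List ℝ), u.2.length = l.length + 2 →
      h.length = l.length + 1 → List.dot v.2.tail h = x0 * v.exitRate →
      Super h (v.elim u) x → Super (x0 :: h) u x := by
    intro u x0 x h hulen hh hx0 hs
    rw [super_elim_iff hv (by omega) (by omega), hx0] at hs
    unfold Super
    rw [dot_eq u x0 h hulen]
    refine le_of_mul_le_mul_right ?_ hm
    linarith
  constructor
  · rintro ⟨xs, hxs, hrows, hy, hstart⟩
    obtain ⟨x0, xs, hvx, hlx, rfl⟩ := List.forall₂_cons_left_iff.1 hrows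
    have hlen := hlx.length_eq
    have hx0 := (super_cons_self_iff hv hv2 (hxs x0 (by simp))).1 hvx
    refine ⟨xs, fun x hx => hxs x (by simp [hx]), ?_, hy,
      down r x0 y _ hr hrlen (by simp [hlen]) hx0 hstart⟩
    rw [List.forall₂_map_left_iff]
    refine List.forall₂_iff_get.2 ⟨hlen, fun i h1 h2 => ?_⟩
    exact down _ x0 _ _ (hl _ (List.get_mem _ _)) (hllen _ (List.get_mem _ _)) (by simp [hlen])
      hx0 ((List.forall₂_iff_get.1 hlx).2 i h1 h2)
  · rintro ⟨xs, hxs, hrows, hy, hstart⟩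
    rw [List.forall₂_map_left_iff] at hrows
    have hlen := hrows.length_eq
    set x0 := List.dot v.2.tail (xs ++ [1]) / v.exitRate with hx0def
    have hx0 : List.dot v.2.tail (xs ++ [1]) = x0 * v.exitRate :=
      (div_mul_cancel₀ _ hm.ne').symm
    have hx0nonneg : 0 ≤ x0 := div_nonneg (List.dot_nonneg
      (fun x hx => hv.2 x (List.mem_of_mem_tail hx)) (by
        intro x hx
        rcases List.mem_append.1 hx with hx | hx
        · exact hxs x hx
        · rw [List.mem_singleton.1 hx]; exact zero_le_one)) hm.le
    refine ⟨x0 :: xs, ?_, ?_, hy, up r x0 y _ hrlen (by simp [hlen]) hx0 hstart⟩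
    · intro x hx
      rcases List.mem_cons.1 hx with rfl | hx
      exacts [hx0nonneg, hxs x hx]
    · refine List.Forall₂.cons ?_ ?_
      · exact (super_cons_self_iff hv hv2 hx0nonneg).2 hx0.le
      · refine List.forall₂_iff_get.2 ⟨hlen, fun i h1 h2 => ?_⟩
        exact up _ x0 _ _ (hllen _ (List.get_mem _ _)) (by simp [hlen]) hx0
          ((List.forall₂_iff_get.1 hrows).2 i h1 h2)

end RateRow

/-! ### Rates of a given order of magnitude -/

/-- The rate `x` is within a factor `K` of `ε ^ i` if `o = some i`, and zero if `o = none`. -/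
def Near (K ε : ℝ) : Option ℕ → ℝ → Prop
  | none, x => x = 0
  | some i, x => ε ^ i ≤ K * x ∧ x ≤ K * ε ^ i

namespace Near

variable {K K' ε x y : ℝ} {a b : Option ℕ}

theorem nonneg (h : Near K ε a x) (hK : 1 ≤ K) (hε : 0 < ε) : 0 ≤ x := by
  cases a with
  | none => exact h.ge
  | some i => exact nonneg_of_mul_nonneg_right ((pow_pos hε i).le.trans h.1) (by linarith)

theorem mono (h : Near K ε a x) (hK : 1 ≤ K) (hε : 0 < ε) (hKK : K ≤ K') : Near K' ε a x := by
  have hx := h.nonneg hK hε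
  cases a with
  | none => exact h
  | some i =>
    exact ⟨h.1.trans (mul_le_mul_of_nonneg_right hKK hx),
      h.2.trans (mul_le_mul_of_nonneg_right hKK (pow_pos hε i).le)⟩

theorem isSome_iff (h : Near K ε a x) (hε : 0 < ε) : a.isSome = true ↔ x ≠ 0 := by
  cases a with
  | none => simpa using (show x = 0 from h)
  | some i =>
    simp only [Option.isSome_some, ne_eq, true_iff]
    rintro rfl
    have h1 := h.1
    have := pow_pos hε i
    linarith

theorem one (hK : 1 ≤ K) : Near K ε (some 0) 1 := by
  constructor <;> simpa using hK

theorem add (ha : Near K ε a x) (hb : Near K ε b y) (hK : 1 ≤ K) (hε : 0 < ε) (hε1 : ε ≤ 1) :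
    Near (2 * K) ε (a.costMin b) (x + y) := by
  have hx := ha.nonneg hK hε
  have hy := hb.nonneg hK hε
  unfold Option.costMin
  cases a with
  | none =>
    obtain rfl : x = 0 := ha
    rw [zero_add]
    exact hb.mono hK hε (by linarith)
  | some i =>
    cases b with
    | none =>
      obtain rfl : y = 0 := hb
      rw [add_zero]
      exact ha.mono hK hε (by linarith)
    | some j =>
      obtain ⟨h1, h2⟩ := ha
      obtain ⟨h3, h4⟩ := hb
      have hKx := mul_nonneg (zero_le_one.trans hK) hx
      have hKy := mul_nonneg (zero_le_one.trans hK) hy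
      by_cases h : i < j
      · have h5 : K * ε ^ j ≤ K * ε ^ i :=
          mul_le_mul_of_nonneg_left (pow_le_pow_of_le_one hε.le hε1 h.le) (by linarith)
        simp only [Option.costLT, h, decide_true, cond_true]
        constructor <;> linarith
      · have h5 : K * ε ^ i ≤ K * ε ^ j :=
          mul_le_mul_of_nonneg_left (pow_le_pow_of_le_one hε.le hε1 (not_lt.1 h)) (by linarith)
        simp only [Option.costLT, h, decide_false, cond_false]
        constructor <;> linarith

theorem mul (ha : Near K ε a x) (hb : Near K ε b y) (hK : 1 ≤ K) (hε : 0 < ε) :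
    Near (K * K) ε (a.costAdd b) (x * y) := by
  have hx := ha.nonneg hK hε
  have hy := hb.nonneg hK hε
  cases a with
  | none =>
    obtain rfl : x = 0 := ha
    exact zero_mul y
  | some i =>
    cases b with
    | none =>
      obtain rfl : y = 0 := hb
      exact mul_zero x
    | some j =>
      obtain ⟨h1, h2⟩ := ha
      obtain ⟨h3, h4⟩ := hb
      have hi := (pow_pos hε i).le
      have hj := (pow_pos hε j).le
      refine ⟨?_, ?_⟩
      · calc ε ^ (i + j) = ε ^ i * ε ^ j := pow_add _ _ _
          _ ≤ (K * x) * (K * y) := mul_le_mul h1 h3 hj (hi.trans h1)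
          _ = K * K * (x * y) := by ring
      · calc x * y ≤ (K * ε ^ i) * (K * ε ^ j) := mul_le_mul h2 h4 hy (hx.trans h2)
          _ = K * K * ε ^ (i + j) := by rw [pow_add]; ring

theorem foldl_add {l : List (Option ℕ)} {l' : List ℝ} (h : List.Forall₂ (Near K ε) l l')
    (hK : 1 ≤ K) (hKK : K ≤ K') (ha : Near K' ε a x) (hε : 0 < ε) (hε1 : ε ≤ 1) :
    Near (2 ^ l.length * K') ε (l.foldl Option.costMin a) (x + l'.sum) := by
  induction h generalizing K' a x with
  | nil => simpa using ha
  | @cons b y l l' hb hl ih =>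
    have h1 := ih (K' := 2 * K') (by linarith)
      (ha.add (hb.mono hK hε hKK) (hK.trans hKK) hε hε1)
    rw [List.foldl_cons, List.length_cons, List.sum_cons, pow_succ, mul_assoc, ← add_assoc]
    exact h1

end Near

/-- The entries of the row `r` have the orders of magnitude given by the exponents `c`. -/
def RowNear (K ε : ℝ) (c : CostRow) (r : RateRow) : Prop :=
  Near K ε c.1 r.1 ∧ List.Forall₂ (Near K ε) c.2 r.2

namespace RowNear

variable {K K' ε : ℝ} {c v : CostRow} {r w : RateRow}

theorem nonneg (h : RowNear K ε c r) (hK : 1 ≤ K) (hε : 0 < ε) : r.Nonneg := by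
  refine ⟨h.1.nonneg hK hε, fun x hx => ?_⟩
  obtain ⟨i, rfl⟩ := List.mem_iff_get.1 hx
  have h1 := (List.forall₂_iff_get.1 h.2).2 i (by rw [h.2.length_eq]; exact i.2) i.2
  exact h1.nonneg hK hε

theorem tail (h : RowNear K ε c r) : List.Forall₂ (Near K ε) c.2.tail r.2.tail := by
  have h2 := h.2
  revert h2
  generalize c.2 = l
  generalize r.2 = l'
  rintro (_ | ⟨-, h⟩)
  exacts [.nil, h]

theorem head (h : RowNear K ε c r) : Near K ε (c.2.headD none) (r.2.headD 0) := by
  have h2 := h.2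
  revert h2
  generalize c.2 = l
  generalize r.2 = l'
  rintro (_ | ⟨h, -⟩)
  exacts [rfl, h]

theorem exit (h : RowNear K ε v w) (hK : 1 ≤ K) (hε : 0 < ε) (hε1 : ε ≤ 1) :
    Near (2 ^ v.2.tail.length * K) ε v.exit w.exit :=
  Near.foldl_add h.tail hK le_rfl h.1 hε hε1

/-- Elimination on exponents gives the orders of magnitude for elimination on rates. -/
theorem elim (hv : RowNear K ε v w) (hr : RowNear K ε c r) (hK : 1 ≤ K) (hε : 0 < ε)
    (hε1 : ε ≤ 1) (hK' : K' = 2 ^ v.2.tail.length * K) :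
    RowNear (2 * (K' * K')) ε (v.elim c) (w.elim r) := by
  have hKK : K ≤ K' := by
    have := one_le_pow₀ (M₀ := ℝ) one_le_two (n := v.2.tail.length)
    rw [hK']
    nlinarith
  have hK1 := hK.trans hKK
  have hKm : 1 ≤ K' * K' := one_le_mul_of_one_le_of_one_le hK1 hK1
  have hexit : Near K' ε v.exit w.exit := hK' ▸ hv.exit hK hε hε1
  have hm : Near K' ε v.exitCost w.exitRate := by
    unfold CostRow.exitCost RateRow.exitRate
    have := hexit.isSome_iff hε
    split_ifs with h
    · rw [Bool.eq_false_iff.2 fun h2 => this.1 h2 h]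
      exact Near.one hK1
    · rw [this.2 h]
      exact hexit
  have hd : Near K' ε v.sinkCost w.sinkRate := by
    unfold CostRow.sinkCost RateRow.sinkRate
    have := hexit.isSome_iff hε
    split_ifs with h
    · rw [Bool.eq_false_iff.2 fun h2 => this.1 h2 h]
      exact Near.one hK1
    · rw [this.2 h]
      exact hv.1.mono hK hε hKK
  have ha := hr.head.mono hK hε hKK
  refine ⟨((hr.1.mono hK hε hKK).mul hm hK1 hε).add (ha.mul hd hK1 hε) hKm hε hε1, ?_⟩
  have key : ∀ {l m : List (Option ℕ)} {l' m' : List ℝ}, List.Forall₂ (Near K ε) l l' →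
      List.Forall₂ (Near K ε) m m' → List.Forall₂ (Near (2 * (K' * K')) ε)
        (List.zipWith (fun x y => (x.costAdd v.exitCost).costMin
          ((c.2.headD none).costAdd y)) l m)
        (List.zipWith (fun x y => x * w.exitRate + r.2.headD 0 * y) l' m') := by
    intro l m l' m' hl
    induction hl generalizing m m' with
    | nil => intro _; simp
    | cons h1 hl ih =>
      rintro (_ | ⟨h2, hm'⟩)
      · simp
      · refine .cons ?_ (ih hm')
        exact ((h1.mono hK hε hKK).mul hm hK1 hε).add (ha.mul (h2.mono hK hε hKK) hK1 hε)
          hKm hε hε1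
  exact key hr.tail hv.tail

end RowNear

/-- After the elimination of all states, the exponents that are left are those of the two rates
that determine the values of the starting point in supersolutions. The constant does not depend
on `ε`. -/
theorem exists_near_foldl_elimFirst (k : ℕ) {K : ℝ} (hK : 1 ≤ K) :
    ∃ K', 1 ≤ K' ∧ ∀ ε, 0 < ε → ε ≤ 1 → ∀ (cl : List CostRow) (c : CostRow) (l : List RateRow)
      (r : RateRow), l.length = k → List.Forall₂ (RowNear K ε) cl l → RowNear K ε c r →
      (∀ u ∈ l, u.2.length = k + 1) → r.2.length = k + 1 →
      ∃ d t, Near K' ε (CostRow.elimFirst^[k] (cl, c)).2.1 d ∧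
        Near K' ε ((CostRow.elimFirst^[k] (cl, c)).2.2.headD none) t ∧
        ∀ y, RateRow.Feasible l r y ↔ 0 ≤ y ∧ t ≤ y * (d + t) := by
  induction k generalizing K with
  | zero =>
    refine ⟨K, hK, fun ε hε hε1 cl c l r hl hcl hc _ hr => ?_⟩
    obtain rfl := List.length_eq_zero_iff.1 hl
    obtain ⟨t, ht⟩ := List.length_eq_one_iff.1 hr
    refine ⟨r.1, t, hc.1, ?_, fun y => ?_⟩
    · have := hc.head
      rwa [ht] at this
    · simp [RateRow.Feasible, RateRow.Super, ht]
  | succ k ih =>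
    set K₁ : ℝ := 2 ^ (k + 1) * K with hK₁
    have hK₁1 : 1 ≤ K₁ := one_le_mul_of_one_le_of_one_le (one_le_pow₀ one_le_two) hK
    have hK₂1 : 1 ≤ 2 * (K₁ * K₁) := by nlinarith
    obtain ⟨K', hK', h⟩ := ih hK₂1
    refine ⟨K', hK', fun ε hε hε1 cl c l r hl hcl hc hlen hr => ?_⟩
    rcases hcl with _ | ⟨hv, hcl⟩
    · simp at hl
    rename_i v w cl l
    have hlk : l.length = k := by simpa using hl
    have hvlen : K₁ = 2 ^ v.2.tail.length * K := by
      rw [hK₁, List.length_tail, hv.2.length_eq, hlen w (by simp)]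
      simp
    have hnn : ∀ u ∈ l, u.Nonneg := by
      intro u hu
      obtain ⟨i, rfl⟩ := List.mem_iff_get.1 hu
      exact ((List.forall₂_iff_get.1 hcl).2 i (by rw [hcl.length_eq]; exact i.2) i.2).nonneg hK hε
    have hlen' : ∀ u : RateRow, u.2.length = k + 2 → (w.elim u).2.length = k + 1 := by
      intro u hu
      simp [RateRow.elim, hu, hlen w (by simp)]
    obtain ⟨d, t, hd, ht, hy⟩ := h ε hε hε1 (cl.map v.elim) (v.elim c) (l.map w.elim) (w.elim r)
      (by simpa using hlk)
      (by
        rw [List.forall₂_map_left_iff, List.forall₂_map_right_iff]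
        exact hcl.imp fun _ _ hu => hv.elim hu hK hε hε1 hvlen)
      (hv.elim hc hK hε hε1 hvlen)
      (by
        intro u hu
        obtain ⟨u', hu', rfl⟩ := List.mem_map.1 hu
        exact hlen' u' (hlen u' (by simp [hu'])))
      (hlen' r hr)
    refine ⟨d, t, hd, ht, fun y => ?_⟩
    rw [← hy]
    exact RateRow.feasible_cons_iff (hv.nonneg hK hε) hnn (hc.nonneg hK hε)
      (by rw [hlk]; exact hlen w (by simp)) (fun u hu => by rw [hlk]; exact hlen u (by simp [hu]))
      (by rw [hlk]; exact hr)

/-- The least value `t / (d + t)` tends to `1` if and only if `d` is of a smaller order of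
magnitude than `t`. -/
theorem tendsto_one_iff_costLT {K : ℝ} (hK : 1 ≤ K) {a b : Option ℕ} {R : ℝ → ℝ}
    (h : ∀ ε, 0 < ε → ε ≤ 1 → ∃ d t, Near K ε a d ∧ Near K ε b t ∧
      IsLeast {y | 0 ≤ y ∧ t ≤ y * (d + t)} (R ε)) :
    Tendsto R (𝓝[>] 0) (𝓝 1) ↔ b.costLT a = true := by
  have hmem : ∀ᶠ ε : ℝ in 𝓝[>] 0, 0 < ε ∧ ε ≤ 1 :=
    (Ioc_mem_nhdsGT zero_lt_one : Set.Ioc (0 : ℝ) 1 ∈ 𝓝[>] 0)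
  constructor
  · intro hR
    by_contra hab
    have hle : ∀ᶠ ε in 𝓝[>] 0, R ε ≤ K * K / (1 + K * K) := by
      filter_upwards [hmem] with ε hε
      obtain ⟨d, t, hd, ht, -, hleast⟩ := h ε hε.1 hε.2
      refine hleast ⟨by positivity, ?_⟩
      have hd0 := hd.nonneg hK hε.1
      have htd : t ≤ K * K * d := by
        cases b with
        | none => rw [show t = 0 from ht]; positivity
        | some j =>
          cases a with
          | none => simp [Option.costLT] at hab
          | some i =>
            have hij : i ≤ j := by simpa [Option.costLT] using hab
            calc t ≤ K * ε ^ j := ht.2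
              _ ≤ K * ε ^ i := mul_le_mul_of_nonneg_left
                (pow_le_pow_of_le_one hε.1.le hε.2 hij) (by linarith)
              _ ≤ K * (K * d) := mul_le_mul_of_nonneg_left hd.1 (by linarith)
              _ = K * K * d := by ring
      rw [div_mul_eq_mul_div, le_div_iff₀ (by positivity)]
      linarith
    have h1 := le_of_tendsto hR hle
    rw [le_div_iff₀ (by positivity)] at h1
    linarith
  · intro hab
    cases b with
    | none => simp [Option.costLT] at hab
    | some j =>
      have hlow : ∀ᶠ ε in 𝓝[>] 0, 1 - K * K * ε ≤ R ε := by
        filter_upwards [hmem] with ε hε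
        obtain ⟨d, t, hd, ht, ⟨hR0, hR⟩, -⟩ := h ε hε.1 hε.2
        have hd0 := hd.nonneg hK hε.1
        have ht0 := ht.nonneg hK hε.1
        have hεj := pow_pos hε.1 j
        have htpos : 0 < t := pos_of_mul_pos_right (hεj.trans_le ht.1) (by linarith)
        have hdt : d ≤ K * K * ε * t := by
          cases a with
          | none =>
            rw [show d = 0 from hd]
            have := hε.1
            positivity
          | some i =>
            have hij : j + 1 ≤ i := by simpa [Option.costLT] using hab
            calc d ≤ K * ε ^ i := hd.2
              _ ≤ K * ε ^ (j + 1) := mul_le_mul_of_nonneg_left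
                (pow_le_pow_of_le_one hε.1.le hε.2 hij) (by linarith)
              _ = K * ε * ε ^ j := by ring
              _ ≤ K * ε * (K * t) := mul_le_mul_of_nonneg_left ht.1
                (mul_nonneg (by linarith) hε.1.le)
              _ = K * K * ε * t := by ring
        -- `R ≥ t / (d + t) ≥ 1 - d / t`
        by_contra hcon
        push Not at hcon
        have h1 : R ε * (d + t) < t := by
          have hRlt1 : R ε < 1 := hcon.trans_le (by
            have := mul_pos (mul_pos (zero_lt_one.trans_le hK) (zero_lt_one.trans_le hK)) hε.1
            linarith)
          have h2 : R ε * t < (1 - K * K * ε) * t := mul_lt_mul_of_pos_right hcon htpos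
          have h3 : R ε * d ≤ d := mul_le_of_le_one_left hd0 hRlt1.le
          linarith
        linarith
      have hup : ∀ᶠ ε in 𝓝[>] 0, R ε ≤ 1 := by
        filter_upwards [hmem] with ε hε
        obtain ⟨d, t, hd, ht, -, hleast⟩ := h ε hε.1 hε.2
        exact hleast ⟨zero_le_one, by linarith [hd.nonneg hK hε.1]⟩
      refine tendsto_of_tendsto_of_tendsto_of_le_of_le' ?_ tendsto_const_nhds hlow hup
      have : Tendsto (fun ε : ℝ => 1 - K * K * ε) (𝓝 0) (𝓝 (1 - K * K * 0)) :=
        (continuous_const.sub (continuous_const.mul continuous_id)).tendsto 0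
      rw [mul_zero, sub_zero] at this
      exact this.mono_left nhdsWithin_le_nhds

/-! ### The probability of reaching the target -/

theorem PMF.lintegral_toMeasure {α : Type*} [MeasurableSpace α] [Countable α]
    [MeasurableSingletonClass α] (p : PMF α) (f : α → ℝ≥0∞) :
    ∫⁻ x, f x ∂p.toMeasure = ∑' x, p x * f x := by
  rw [lintegral_countable']
  exact tsum_congr fun x => by
    rw [p.toMeasure_apply_singleton x (measurableSet_singleton x), mul_comm]

theorem PMF.tsum_bind_mul {α β : Type*} (p : PMF α) (q : α → PMF β) (f : β → ℝ≥0∞) :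
    ∑' y, p.bind q y * f y = ∑' x, p x * ∑' y, q x y * f y := by
  simp only [PMF.bind_apply, ← ENNReal.tsum_mul_right, ← ENNReal.tsum_mul_left, mul_assoc]
  exact ENNReal.tsum_comm

theorem PMF.tsum_map_mul {α β : Type*} (p : PMF α) (g : α → β) (f : β → ℝ≥0∞) :
    ∑' y, p.map g y * f y = ∑' x, p x * f (g x) := by
  rw [PMF.map, PMF.tsum_bind_mul]
  refine tsum_congr fun x => ?_
  rw [tsum_eq_single (g x) fun y hy => by simp [PMF.pure_apply, hy]]
  simp

theorem ProbabilityTheory.Kernel.map_eval_zero_trajMeasure {X : ℕ → Type*}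
    [∀ n, MeasurableSpace (X n)] {μ₀ : Measure (X 0)} [IsProbabilityMeasure μ₀]
    {κ : (n : ℕ) → Kernel (Π i : Finset.Iic n, X i) (X (n + 1))} [∀ n, IsMarkovKernel (κ n)] :
    (Kernel.trajMeasure μ₀ κ).map (fun ω => ω 0) = μ₀ := by
  have h : (fun ω : (n : ℕ) → X n => ω 0) =
      (fun h => h ⟨0, Finset.mem_Iic.2 le_rfl⟩) ∘ Preorder.frestrictLe 0 := rfl
  rw [h, ← Measure.map_map (by fun_prop) (by fun_prop), Kernel.trajMeasure,
    Measure.map_comp _ _ (by fun_prop), Kernel.traj_map_frestrictLe, Kernel.partialTraj_self,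
    Measure.id_comp]
  exact (Measure.map_map (measurable_pi_apply _) (MeasurableEquiv.measurable _)).trans
    Measure.map_id

theorem PMF.sum_coe {α : Type*} [Fintype α] (p : PMF α) : ∑ x, p x = 1 := by
  rw [← tsum_fintype (L := .unconditional _), p.tsum_coe]

namespace BlindMDP

variable {n m : ℕ} (M : BlindMDP n m) (σ : PMF (Fin m)) (target : Fin n)

/-- The probability of avoiding the target now and in the next `k` steps, from the given pair of
a state and an action. -/
noncomputable def avoidPair : ℕ → Fin n × Fin m → ℝ≥0∞
  | 0, p => if p.1 = target then 0 else 1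
  | k + 1, p => if p.1 = target then 0 else ∫⁻ q, avoidPair k q ∂(M.next σ p).toMeasure

/-- The probability of avoiding the target now and in the next `k` steps, from the given state. -/
noncomputable def avoid (k : ℕ) (s : Fin n) : ℝ≥0∞ := ∑ a, σ a * M.avoidPair σ target k (s, a)

/-- The probability of moving from `s` to `s'` in one step. -/
noncomputable def stepProb (s s' : Fin n) : ℝ≥0∞ := ∑ a, σ a * M.trans s a s'

theorem sum_stepProb (s : Fin n) : ∑ s', M.stepProb σ s s' = 1 := by
  simp only [stepProb]
  rw [Finset.sum_comm]
  simp only [← Finset.mul_sum, PMF.sum_coe, mul_one]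

theorem avoid_zero (s : Fin n) : M.avoid σ target 0 s = if s = target then 0 else 1 := by
  simp only [avoid, avoidPair]
  split_ifs
  · simp
  · simp only [mul_one, PMF.sum_coe]

theorem avoid_succ (k : ℕ) (s : Fin n) : M.avoid σ target (k + 1) s =
    if s = target then 0 else ∑ s', M.stepProb σ s s' * M.avoid σ target k s' := by
  simp only [avoid, avoidPair]
  split_ifs
  · simp
  · simp only [PMF.lintegral_toMeasure, next, PMF.tsum_bind_mul, PMF.tsum_map_mul]
    simp only [tsum_fintype, stepProb, Finset.sum_mul, Finset.mul_sum]
    rw [Finset.sum_comm]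
    refine Finset.sum_congr rfl fun s' _ => ?_
    rw [Finset.sum_comm]
    refine Finset.sum_congr rfl fun a _ => Finset.sum_congr rfl fun b _ => ?_
    ring

instance : IsProbabilityMeasure (M.playMeasure σ) := by
  unfold playMeasure
  infer_instance

/-- Avoiding the target up to time `k` and then for `j + 1` more steps is the same as avoiding it
up to time `k + 1` and then for `j` more steps. -/
theorem lintegral_avoidPair_succ (k j : ℕ) :
    ∫⁻ ω, (if ∀ i < k, (ω i).1 ≠ target then 1 else 0) * M.avoidPair σ target (j + 1) (ω k)
      ∂M.playMeasure σ =
    ∫⁻ ω, (if ∀ i < k + 1, (ω i).1 ≠ target then 1 else 0) * M.avoidPair σ target j (ω (k + 1))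
      ∂M.playMeasure σ := by
  have hmap : (M.playMeasure σ).map (Preorder.frestrictLe k) ⊗ₘ M.nextKernel σ k =
      (M.playMeasure σ).map (fun ω => (Preorder.frestrictLe k ω, ω (k + 1))) :=
    Kernel.map_frestrictLe_trajMeasure_compProd_eq_map_trajMeasure
  -- The indicator of avoiding the target in a history.
  let φ : (Π _ : Finset.Iic k, Fin n × Fin m) → ℝ≥0∞ :=
    fun h => if ∀ i, (h i).1 ≠ target then 1 else 0
  have hφ : Measurable φ := measurable_of_countable φ
  have hg : Measurable (M.avoidPair σ target j) := measurable_of_countable _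
  have hφ_restrict : ∀ ω : ℕ → Fin n × Fin m, φ (Preorder.frestrictLe k ω) =
      if ∀ i < k + 1, (ω i).1 ≠ target then 1 else 0 := by
    intro ω
    refine if_congr ⟨fun h i hi => h ⟨i, Finset.mem_Iic.2 (by omega)⟩, fun h i => ?_⟩ rfl rfl
    exact h i (by have := Finset.mem_Iic.1 i.2; omega)
  have hf : Measurable fun p : (Π _ : Finset.Iic k, Fin n × Fin m) × (Fin n × Fin m) =>
      φ p.1 * M.avoidPair σ target j p.2 := (hφ.comp measurable_fst).mul (hg.comp measurable_snd)
  calc _ = ∫⁻ ω, φ (Preorder.frestrictLe k ω) *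
        ∫⁻ q, M.avoidPair σ target j q ∂(M.nextKernel σ k (Preorder.frestrictLe k ω))
        ∂M.playMeasure σ := by
        refine lintegral_congr fun ω => ?_
        rw [hφ_restrict, avoidPair]
        have hlast :
            ∫⁻ q, M.avoidPair σ target j q ∂(M.nextKernel σ k (Preorder.frestrictLe k ω)) =
          ∫⁻ q, M.avoidPair σ target j q ∂(M.next σ (ω k)).toMeasure := rfl
        rw [hlast]
        have hiff : (∀ i < k + 1, (ω i).1 ≠ target) ↔
            (∀ i < k, (ω i).1 ≠ target) ∧ (ω k).1 ≠ target := Nat.forall_lt_succ_right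
        simp only [hiff]
        by_cases h2 : (ω k).1 = target <;> simp [h2]
    _ = ∫⁻ h, φ h * ∫⁻ q, M.avoidPair σ target j q ∂(M.nextKernel σ k h)
        ∂(M.playMeasure σ).map (Preorder.frestrictLe k) := by
        rw [lintegral_map (measurable_of_countable _) (by fun_prop)]
    _ = ∫⁻ p, φ p.1 * M.avoidPair σ target j p.2
        ∂((M.playMeasure σ).map (Preorder.frestrictLe k) ⊗ₘ M.nextKernel σ k) := by
        rw [Measure.lintegral_compProd hf]
        exact lintegral_congr fun h => (lintegral_const_mul _ hg).symm
    _ = _ := by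
        rw [hmap, lintegral_map hf (by fun_prop)]
        exact lintegral_congr fun ω => by rw [hφ_restrict]

/-- The probability of avoiding the target up to time `k`. -/
theorem playMeasure_avoid (k : ℕ) :
    M.playMeasure σ {ω | ∀ i < k + 1, (ω i).1 ≠ target} = M.avoid σ target k M.s₀ := by
  have key : ∀ j l, ∫⁻ ω, (if ∀ i < l, (ω i).1 ≠ target then 1 else 0) *
      M.avoidPair σ target j (ω l) ∂M.playMeasure σ =
      ∫⁻ ω, (if ∀ i < l + j, (ω i).1 ≠ target then 1 else 0) *
        M.avoidPair σ target 0 (ω (l + j)) ∂M.playMeasure σ := by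
    intro j
    induction j with
    | zero => exact fun l => rfl
    | succ j ih =>
      intro l
      rw [lintegral_avoidPair_succ, ih (l + 1), show l + 1 + j = l + (j + 1) by omega]
  have h := key k 0
  have hfirst : ∫⁻ ω, M.avoidPair σ target k (ω 0) ∂M.playMeasure σ = M.avoid σ target k M.s₀ := by
    have h0 : (M.playMeasure σ).map (fun ω => ω 0) = (M.first σ).toMeasure :=
      Kernel.map_eval_zero_trajMeasure
    rw [← lintegral_map (f := M.avoidPair σ target k) (measurable_of_countable _) (by fun_prop), h0,
      PMF.lintegral_toMeasure, first, PMF.tsum_map_mul, tsum_fintype]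
    rfl
  simp only [not_lt_zero, false_implies, implies_true, if_true, one_mul, zero_add] at h
  rw [hfirst] at h
  rw [h]
  have hmeas : MeasurableSet {ω : ℕ → Fin n × Fin m | ∀ i < k + 1, (ω i).1 ≠ target} := by
    measurability
  rw [← lintegral_indicator_one hmeas]
  refine lintegral_congr fun ω => ?_
  have hiff : (∀ i < k + 1, (ω i).1 ≠ target) ↔
      (∀ i < k, (ω i).1 ≠ target) ∧ (ω k).1 ≠ target := Nat.forall_lt_succ_right
  simp only [Set.indicator_apply, Set.mem_ofPred_eq, hiff, avoidPair]
  by_cases h2 : (ω k).1 = target <;> simp [h2]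

theorem stepProb_le_one (s s' : Fin n) : M.stepProb σ s s' ≤ 1 :=
  (Finset.single_le_sum (fun _ _ => zero_le) (Finset.mem_univ s')).trans_eq
    (M.sum_stepProb σ s)

theorem avoid_le_one (k : ℕ) (s : Fin n) : M.avoid σ target k s ≤ 1 := by
  induction k generalizing s with
  | zero =>
    rw [avoid_zero]
    split_ifs <;> simp
  | succ k ih =>
    rw [avoid_succ]
    split_ifs
    · simp
    · calc _ ≤ ∑ s', M.stepProb σ s s' * 1 := by gcongr; exact ih _
        _ = 1 := by simp only [mul_one, sum_stepProb]

/-- The probability of reaching the target within `k` steps, from the given state. -/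
noncomputable def reachWithin (k : ℕ) (s : Fin n) : ℝ := 1 - (M.avoid σ target k s).toReal

theorem reachWithin_zero (s : Fin n) :
    M.reachWithin σ target 0 s = if s = target then 1 else 0 := by
  rw [reachWithin, avoid_zero]
  split_ifs <;> simp

theorem sum_stepProb_toReal (s : Fin n) : ∑ s', (M.stepProb σ s s').toReal = 1 := by
  rw [← ENNReal.toReal_sum fun s' _ => ne_top_of_le_ne_top ENNReal.one_ne_top
    (M.stepProb_le_one σ s s'), sum_stepProb, ENNReal.toReal_one]

theorem reachWithin_succ (k : ℕ) (s : Fin n) : M.reachWithin σ target (k + 1) s =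
    if s = target then 1 else ∑ s', (M.stepProb σ s s').toReal * M.reachWithin σ target k s' := by
  simp only [reachWithin, avoid_succ]
  split_ifs
  · simp
  · simp only [mul_sub, mul_one, Finset.sum_sub_distrib, sum_stepProb_toReal]
    rw [ENNReal.toReal_sum fun s' _ => ENNReal.mul_ne_top
      (ne_top_of_le_ne_top ENNReal.one_ne_top (M.stepProb_le_one σ s s'))
      (ne_top_of_le_ne_top ENNReal.one_ne_top (M.avoid_le_one σ target k s'))]
    simp only [ENNReal.toReal_mul]

theorem reachWithin_nonneg (k : ℕ) (s : Fin n) : 0 ≤ M.reachWithin σ target k s :=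
  sub_nonneg.2 (ENNReal.toReal_le_of_le_ofReal zero_le_one
    (by simpa using M.avoid_le_one σ target k s))

theorem reachWithin_le_one (k : ℕ) (s : Fin n) : M.reachWithin σ target k s ≤ 1 :=
  sub_le_self _ ENNReal.toReal_nonneg

theorem reachWithin_mono (s : Fin n) : Monotone fun k => M.reachWithin σ target k s := by
  refine monotone_nat_of_le_succ fun k => ?_
  induction k generalizing s with
  | zero =>
    rw [reachWithin_zero]
    split_ifs with h
    · rw [reachWithin_succ, if_pos h]
    · exact M.reachWithin_nonneg σ target _ s
  | succ k ih =>
    rw [reachWithin_succ, reachWithin_succ]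
    split_ifs
    · exact le_rfl
    · gcongr with s' _
      exact ih s'

/-- The probability of reaching the target, from the given state. -/
noncomputable def reachProb (s : Fin n) : ℝ := ⨆ k, M.reachWithin σ target k s

theorem tendsto_reachWithin (s : Fin n) :
    Tendsto (fun k => M.reachWithin σ target k s) atTop (𝓝 (M.reachProb σ target s)) :=
  tendsto_atTop_ciSup (M.reachWithin_mono σ target s)
    ⟨1, by rintro _ ⟨k, rfl⟩; exact M.reachWithin_le_one σ target k s⟩

theorem toReal_playMeasure_reach :
    (M.playMeasure σ (reach target)).toReal = M.reachProb σ target M.s₀ := by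
  have hmeas : ∀ k, MeasurableSet {ω : ℕ → Fin n × Fin m | ∀ i < k + 1, (ω i).1 ≠ target} := by
    intro k
    measurability
  have hunion : reach target =
      ⋃ k, {ω : ℕ → Fin n × Fin m | ∀ i < k + 1, (ω i).1 ≠ target}ᶜ := by
    ext ω
    simp only [reach, Set.mem_iUnion, Set.mem_compl_iff, Set.mem_ofPred_eq]
    push Not
    exact ⟨fun ⟨i, hi⟩ => ⟨i, i, by omega, hi⟩, fun ⟨_, i, _, hi⟩ => ⟨i, hi⟩⟩
  have hmono : Monotone fun k => {ω : ℕ → Fin n × Fin m | ∀ i < k + 1, (ω i).1 ≠ target}ᶜ := by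
    intro k l hkl
    refine Set.compl_subset_compl.2 fun ω h i hi => h i (by omega)
  have h1 := tendsto_measure_iUnion_atTop (μ := M.playMeasure σ) hmono
  rw [← hunion] at h1
  have h2 := (ENNReal.tendsto_toReal (measure_ne_top (M.playMeasure σ) (reach target))).comp h1
  refine tendsto_nhds_unique h2 ((M.tendsto_reachWithin σ target M.s₀).congr fun k => ?_)
  simp only [Function.comp_apply]
  rw [prob_compl_eq_one_sub (hmeas k), playMeasure_avoid, ENNReal.toReal_sub_of_le
    (M.avoid_le_one σ target k M.s₀) ENNReal.one_ne_top, ENNReal.toReal_one, reachWithin]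

theorem reachProb_nonneg (s : Fin n) : 0 ≤ M.reachProb σ target s :=
  ge_of_tendsto' (M.tendsto_reachWithin σ target s) fun k => M.reachWithin_nonneg σ target k s

theorem reachProb_target : M.reachProb σ target target = 1 := by
  refine tendsto_nhds_unique (M.tendsto_reachWithin σ target target)
    (tendsto_const_nhds.congr fun k => ?_)
  cases k <;> simp [reachWithin_zero, reachWithin_succ]

theorem reachProb_eq_sum {s : Fin n} (hs : s ≠ target) : M.reachProb σ target s =
    ∑ s', (M.stepProb σ s s').toReal * M.reachProb σ target s' := by
  refine tendsto_nhds_unique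
    ((tendsto_add_atTop_iff_nat 1).2 (M.tendsto_reachWithin σ target s)) ?_
  simp only [reachWithin_succ, if_neg hs]
  exact tendsto_finsetSum _ fun s' _ => (M.tendsto_reachWithin σ target s').const_mul _

/-- Together with `reachProb_target` and `reachProb_eq_sum`: the probability of reaching the target
is the least nonnegative supersolution of the one-step equations. -/
theorem reachProb_le {x : Fin n → ℝ} (hx : ∀ s, 0 ≤ x s) (htarget : 1 ≤ x target)
    (hstep : ∀ s ≠ target, ∑ s', (M.stepProb σ s s').toReal * x s' ≤ x s) (s : Fin n) :
    M.reachProb σ target s ≤ x s := by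
  refine le_of_tendsto' (M.tendsto_reachWithin σ target s) fun k => ?_
  induction k generalizing s with
  | zero =>
    rw [reachWithin_zero]
    split_ifs with h
    exacts [h ▸ htarget, hx s]
  | succ k ih =>
    rw [reachWithin_succ]
    split_ifs with h
    · exact h ▸ htarget
    · refine le_trans ?_ (hstep s h)
      gcongr with s' _
      exact ih s'

end BlindMDP

/-! ### The rows of the input -/

theorem List.zipWith_ofFn {α β γ : Type*} {n : ℕ} (F : α → β → γ) (f : Fin n → α)
    (g : Fin n → β) : List.zipWith F (List.ofFn f) (List.ofFn g) =
      List.ofFn fun i => F (f i) (g i) := by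
  simp only [List.ofFn_eq_map, List.zipWith_map, List.zipWith_self]

theorem List.dot_ofFn_append {n : ℕ} (f x : Fin n → ℝ) (c : ℝ) :
    List.dot (List.ofFn f ++ [c]) (List.ofFn x ++ [1]) = ∑ i, f i * x i + c := by
  rw [List.dot, List.zipWith_append (by simp), List.zipWith_ofFn, List.sum_append, List.sum_ofFn]
  simp

theorem List.range_eq_ofFn (n : ℕ) : List.range n = List.ofFn fun i : Fin n => (i : ℕ) := by
  rw [List.ofFn_eq_map, List.map_coe_finRange_eq_range]

theorem minCosts_ofFn {ι : Type*} {n : ℕ} (l : List ι) (b : Fin n → Option ℕ)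
    (v : ι → Fin n → Option ℕ) : minCosts (List.ofFn b) (l.map fun a => List.ofFn (v a)) =
      List.ofFn fun i => (l.map fun a => v a i).foldl Option.costMin (b i) := by
  induction l generalizing b with
  | nil => rfl
  | cons a l ih =>
    simp only [minCosts, List.map_cons, List.foldl_cons] at ih ⊢
    rw [List.zipWith_ofFn, ih]

namespace VerifierInput

variable (I : VerifierInput)

/-- The exponent of the transition rate from `s` to `s'` under the action `a`. -/
def actionCost (s s' : Fin I.n) (a : Fin I.m) : Option ℕ :=
  bif decide (I.mdp.δ s a s' ≠ 0) then I.policy.rank a else none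

/-- The exponent of the transition rate from `s` to `s'`. -/
def cost (s s' : Fin I.n) : Option ℕ :=
  ((List.finRange I.m).map (I.actionCost s s')).foldl Option.costMin none

/-- The transition rate from `s` to `s'`, which is the transition probability up to the
normalization of the weights of the actions. -/
noncomputable def rate (ε : ℝ≥0) (s s' : Fin I.n) : ℝ :=
  ∑ a, (I.policy.weight ε a : ℝ) * (I.mdp.δ s a s' : ℝ)

/-- The row of exponents of the state `s`. -/
def costRow (s : Fin I.n) : CostRow :=
  if s = I.target then (none, (List.ofFn fun _ : Fin I.n => none) ++ [some 0])
  else (none, List.ofFn (I.cost s) ++ [none])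

/-- The row of rates of the state `s`. -/
noncomputable def rateRow (ε : ℝ≥0) (s : Fin I.n) : RateRow :=
  if s = I.target then (0, (List.ofFn fun _ : Fin I.n => 0) ++ [1])
  else (0, List.ofFn (I.rate ε s) ++ [0])

/-- The row of rates of the starting point. -/
noncomputable def startRateRow : RateRow :=
  (0, (List.ofFn fun s : Fin I.n => if s = I.mdp.s₀ then 1 else 0) ++ [0])

theorem initialRows_eq : initialRows I.table I.target I.ranks = List.ofFn I.costRow := by
  have hbase : (I.table.map fun _ => (none : Option ℕ)) = List.ofFn fun _ : Fin I.n => none := by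
    simp [table, List.map_ofFn, Function.comp_def]
  have htrans : ∀ s, transCosts (List.ofFn fun _ : Fin I.n => none)
      (List.ofFn fun a => List.ofFn fun s' => I.mdp.δ s a s') I.ranks = List.ofFn (I.cost s) := by
    intro s
    rw [transCosts, ranks, List.zipWith_ofFn]
    simp only [List.map_ofFn, Function.comp_def]
    have h := minCosts_ofFn (List.finRange I.m) (fun _ => none) fun a s' => I.actionCost s s' a
    rw [← List.ofFn_eq_map] at h
    exact h
  rw [initialRows, hbase, table, List.length_ofFn, List.range_eq_ofFn, List.zipWith_ofFn]
  congr 1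
  funext s
  rw [initialRow, htrans, costRow]
  by_cases h : s = I.target
  · simp [h]
  · simp [h, Fin.val_inj]

theorem startRow_eq : startRow I.table.length I.mdp.s₀ =
    (none, (List.ofFn fun s : Fin I.n => if s = I.mdp.s₀ then some 0 else none) ++ [none]) := by
  rw [startRow, table, List.length_ofFn, List.range_eq_ofFn, List.map_ofFn]
  congr 3
  funext s
  by_cases h : s = I.mdp.s₀
  · simp [h]
  · simp [h, Fin.val_inj]

/-- The exponents of all transition rates give the orders of magnitude, with a constant that does
not depend on `ε`. -/
theorem exists_near_cost : ∃ K : ℝ, 1 ≤ K ∧ ∀ ε : ℝ≥0, 0 < ε → ε ≤ 1 → ∀ s s',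
    Near K ε (I.cost s s') (I.rate ε s s') := by
  obtain ⟨K, hK⟩ : ∃ K : ℝ, K = 1 + ∑ s, ∑ a, ∑ s', ((I.mdp.δ s a s' : ℝ))⁻¹ := ⟨_, rfl⟩
  have hδ : ∀ s a s', (0 : ℝ) ≤ (I.mdp.δ s a s' : ℝ) := fun s a s' => by positivity
  have hK1 : 1 ≤ K := by
    rw [hK]
    exact le_add_of_nonneg_right (Finset.sum_nonneg fun s _ => Finset.sum_nonneg fun a _ =>
      Finset.sum_nonneg fun s' _ => inv_nonneg.2 (hδ s a s'))
  have hKδ : ∀ s a s', I.mdp.δ s a s' ≠ 0 → 1 ≤ K * (I.mdp.δ s a s' : ℝ) := by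
    intro s a s' h
    have hpos : (0 : ℝ) < (I.mdp.δ s a s' : ℝ) := by exact_mod_cast pos_iff_ne_zero.2 h
    have h1 : ((I.mdp.δ s a s' : ℝ))⁻¹ ≤ K := by
      have e1 := Finset.single_le_sum (f := fun s' => ((I.mdp.δ s a s' : ℝ))⁻¹)
        (fun s' _ => inv_nonneg.2 (hδ s a s')) (Finset.mem_univ s')
      have e2 := Finset.single_le_sum (f := fun a => ∑ s', ((I.mdp.δ s a s' : ℝ))⁻¹)
        (fun a _ => Finset.sum_nonneg fun s' _ => inv_nonneg.2 (hδ s a s')) (Finset.mem_univ a)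
      have e3 := Finset.single_le_sum (f := fun s => ∑ a, ∑ s', ((I.mdp.δ s a s' : ℝ))⁻¹)
        (fun s _ => Finset.sum_nonneg fun a _ => Finset.sum_nonneg fun s' _ =>
          inv_nonneg.2 (hδ s a s')) (Finset.mem_univ s)
      linarith
    calc (1 : ℝ) = ((I.mdp.δ s a s' : ℝ))⁻¹ * (I.mdp.δ s a s' : ℝ) :=
          (inv_mul_cancel₀ hpos.ne').symm
      _ ≤ _ := mul_le_mul_of_nonneg_right h1 hpos.le
  have hδ1 : ∀ s a s', (I.mdp.δ s a s' : ℝ) ≤ 1 := by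
    intro s a s'
    have h1 := Finset.single_le_sum (f := fun s' => I.mdp.δ s a s') (fun _ _ => zero_le)
      (Finset.mem_univ s')
    rw [I.mdp.δ_sum] at h1
    exact_mod_cast h1
  refine ⟨2 ^ I.m * K, one_le_mul_of_one_le_of_one_le (one_le_pow₀ one_le_two) hK1,
    fun ε hε hε1 s s' => ?_⟩
  have hε' : (0 : ℝ) < ε := by exact_mod_cast hε
  have key : ∀ a, Near K ε (I.actionCost s s' a)
      ((I.policy.weight ε a : ℝ) * (I.mdp.δ s a s' : ℝ)) := by
    intro a
    unfold actionCost RankPolicy.weight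
    by_cases h : I.mdp.δ s a s' = 0
    · simp [h, Near]
    · simp only [ne_eq, h, not_false_eq_true, decide_true, cond_true]
      cases I.policy.rank a with
      | none => simp [Near]
      | some i =>
        have hi := pow_pos hε' i
        simp only [NNReal.coe_pow]
        constructor
        · calc (ε : ℝ) ^ i = ε ^ i * 1 := (mul_one _).symm
            _ ≤ ε ^ i * (K * (I.mdp.δ s a s' : ℝ)) :=
              mul_le_mul_of_nonneg_left (hKδ s a s' h) hi.le
            _ = _ := by ring
        · calc (ε : ℝ) ^ i * (I.mdp.δ s a s' : ℝ) ≤ ε ^ i * K :=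
              mul_le_mul_of_nonneg_left ((hδ1 s a s').trans hK1) hi.le
            _ = _ := mul_comm _ _
  have h := Near.foldl_add (a := none) (x := 0) (K' := K)
    (l := (List.finRange I.m).map (I.actionCost s s'))
    (l' := (List.finRange I.m).map fun a => (I.policy.weight ε a : ℝ) * (I.mdp.δ s a s' : ℝ))
    (by
      rw [List.forall₂_map_left_iff, List.forall₂_map_right_iff, List.forall₂_same]
      exact fun a _ => key a) hK1 le_rfl rfl hε' (by exact_mod_cast hε1)
  rw [← List.ofFn_eq_map (f := fun a => (I.policy.weight ε a : ℝ) * (I.mdp.δ s a s' : ℝ)),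
    List.sum_ofFn, zero_add, List.length_map, List.length_finRange] at h
  exact h

theorem _root_.List.forall₂_ofFn {α β : Type*} {R : α → β → Prop} {n : ℕ} {f : Fin n → α}
    {g : Fin n → β} : List.Forall₂ R (List.ofFn f) (List.ofFn g) ↔ ∀ i, R (f i) (g i) := by
  simp [List.ofFn_eq_map, List.forall₂_map_left_iff, List.forall₂_map_right_iff,
    List.forall₂_same]

theorem rowNear_append {K ε : ℝ} {n : ℕ} {f : Fin n → Option ℕ} {g : Fin n → ℝ} {c : Option ℕ}
    {x : ℝ} (h : ∀ i, Near K ε (f i) (g i)) (hc : Near K ε c x) :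
    RowNear K ε (none, List.ofFn f ++ [c]) (0, List.ofFn g ++ [x]) :=
  ⟨rfl, List.rel_append (List.forall₂_ofFn.2 h) (.cons hc .nil)⟩

/-- Supersolutions in the sense of the rows of the input are supersolutions of the one-step
equations, multiplied by the total weight of the actions. -/
theorem feasible_rateRow_iff (ε : ℝ≥0) (y : ℝ) :
    RateRow.Feasible (List.ofFn (I.rateRow ε)) I.startRateRow y ↔
      ∃ x : Fin I.n → ℝ, (∀ s, 0 ≤ x s) ∧ 1 ≤ x I.target ∧
        (∀ s ≠ I.target, ∑ s', I.rate ε s s' * x s' ≤ x s * ∑ s', I.rate ε s s') ∧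
        x I.mdp.s₀ ≤ y := by
  have hrow : ∀ (x : Fin I.n → ℝ) s, RateRow.Super (List.ofFn x ++ [1]) (I.rateRow ε s) (x s) ↔
      if s = I.target then 1 ≤ x s else
        ∑ s', I.rate ε s s' * x s' ≤ x s * ∑ s', I.rate ε s s' := by
    intro x s
    unfold RateRow.Super rateRow
    split_ifs
    · simp only [List.dot_ofFn_append, List.sum_append, List.sum_ofFn]
      simp
    · simp only [List.dot_ofFn_append, List.sum_append, List.sum_ofFn]
      simp
  have hstart : ∀ x : Fin I.n → ℝ, RateRow.Super (List.ofFn x ++ [1]) I.startRateRow y ↔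
      x I.mdp.s₀ ≤ y := by
    intro x
    unfold RateRow.Super startRateRow
    simp only [List.dot_ofFn_append, List.sum_append, List.sum_ofFn]
    simp
  constructor
  · rintro ⟨xs, hxs, hrows, -, hy⟩
    obtain ⟨x, rfl⟩ : ∃ x : Fin I.n → ℝ, xs = List.ofFn x := by
      have hlen : xs.length = I.n := by rw [← hrows.length_eq, List.length_ofFn]
      exact ⟨fun i => xs.get (i.cast hlen.symm), List.ext_getElem (by simp [hlen]) (by simp)⟩
    rw [List.forall₂_ofFn] at hrows
    refine ⟨x, fun s => hxs _ (by simp), ?_, fun s hs => ?_, (hstart x).1 hy⟩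
    · simpa using (hrow x I.target).1 (hrows I.target)
    · simpa [hs] using (hrow x s).1 (hrows s)
  · rintro ⟨x, hx, htarget, hstep, hy⟩
    refine ⟨List.ofFn x, by simpa [List.mem_ofFn] using hx, List.forall₂_ofFn.2 fun s => ?_,
      (hx _).trans hy, (hstart x).2 hy⟩
    rw [hrow]
    split_ifs with hs
    exacts [hs ▸ htarget, hstep s hs]

theorem sum_rate (ε : ℝ≥0) (s : Fin I.n) :
    ∑ s', I.rate ε s s' = ∑ a, (I.policy.weight ε a : ℝ) := by
  unfold rate
  rw [Finset.sum_comm]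
  refine Finset.sum_congr rfl fun a _ => ?_
  have h : ∑ s', (I.mdp.δ s a s' : ℝ) = 1 := by exact_mod_cast I.mdp.δ_sum s a
  rw [← Finset.mul_sum, h, mul_one]

theorem sum_weight_pos (ε : Set.Ioi (0 : ℝ≥0)) : 0 < ∑ a, (I.policy.weight ε a : ℝ) := by
  obtain ⟨a, ha⟩ := I.policy.exists_rank
  obtain ⟨i, hi⟩ := Option.ne_none_iff_exists'.1 ha
  refine Finset.sum_pos' (fun _ _ => NNReal.coe_nonneg _) ⟨a, Finset.mem_univ _, ?_⟩
  have hε : (0 : ℝ≥0) < ε := ε.2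
  simp only [RankPolicy.weight, hi]
  exact_mod_cast pow_pos hε i

theorem stepProb_toReal (ε : Set.Ioi (0 : ℝ≥0)) (s s' : Fin I.n) :
    (I.mdp.stepProb (I.policy.policy ε) s s').toReal =
      I.rate ε s s' / ∑ a, (I.policy.weight ε a : ℝ) := by
  have hsum : (∑' a, (I.policy.weight ε a : ℝ≥0∞)) =
      ((∑ a, I.policy.weight ε a : ℝ≥0) : ℝ≥0∞) := by
    rw [tsum_fintype]
    push_cast
    rfl
  rw [BlindMDP.stepProb, ENNReal.toReal_sum fun a _ => ENNReal.mul_ne_top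
    (PMF.apply_ne_top _ _) (PMF.apply_ne_top _ _), rate, Finset.sum_div]
  refine Finset.sum_congr rfl fun a _ => ?_
  rw [RankPolicy.policy, PMF.normalize_apply, hsum, BlindMDP.trans, PMF.ofFintype_apply]
  simp only [ENNReal.toReal_mul, ENNReal.toReal_inv, ENNReal.coe_toReal, NNReal.coe_sum]
  rw [show ((I.mdp.δ s a s' : ℝ≥0) : ℝ) = (I.mdp.δ s a s' : ℝ) from rfl]
  ring

/-- The probability of reaching the target is the least feasible value of the starting point. -/
theorem isLeast_reachProb (ε : Set.Ioi (0 : ℝ≥0)) :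
    IsLeast {y | RateRow.Feasible (List.ofFn (I.rateRow ε)) I.startRateRow y}
      (I.mdp.playMeasure (I.policy.policy ε) (BlindMDP.reach I.target)).toReal := by
  have hW := I.sum_weight_pos ε
  have hiff : ∀ (x : Fin I.n → ℝ) s, ∑ s', I.rate ε s s' * x s' ≤ x s * ∑ s', I.rate ε s s' ↔
      ∑ s', (I.mdp.stepProb (I.policy.policy ε) s s').toReal * x s' ≤ x s := by
    intro x s
    simp only [stepProb_toReal, sum_rate, div_mul_eq_mul_div]
    rw [← Finset.sum_div, div_le_iff₀ hW]
  rw [BlindMDP.toReal_playMeasure_reach]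
  constructor
  · exact (I.feasible_rateRow_iff ε _).2 ⟨I.mdp.reachProb (I.policy.policy ε) I.target,
      I.mdp.reachProb_nonneg _ _, (I.mdp.reachProb_target _ _).ge,
      fun s hs => (hiff _ s).2 (I.mdp.reachProb_eq_sum _ _ hs).ge, le_rfl⟩
  · intro y hy
    obtain ⟨x, hx, htarget, hstep, hle⟩ := (I.feasible_rateRow_iff ε y).1 hy
    exact (I.mdp.reachProb_le _ _ hx htarget (fun s hs => (hiff x s).1 (hstep s hs)) _).trans hle

/-- The probability of reaching the target as a function of a real parameter. -/
noncomputable def reachProbAt (ε : ℝ) : ℝ :=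
  if h : 0 < ε.toNNReal then
    (I.mdp.playMeasure (I.policy.policy ⟨ε.toNNReal, h⟩) (BlindMDP.reach I.target)).toReal
  else 0

theorem isWitness_iff_tendsto_reachProbAt :
    I.policy.IsWitness I.mdp I.target ↔ Tendsto I.reachProbAt (𝓝[>] 0) (𝓝 1) := by
  have hfilter : comap Subtype.val (𝓝[>] (0 : ℝ≥0)) =
      comap (fun ε : Set.Ioi (0 : ℝ≥0) => ((ε : ℝ≥0) : ℝ)) (𝓝[>] 0) := by
    have h : 𝓝[>] (0 : ℝ≥0) = comap ((↑) : ℝ≥0 → ℝ) (𝓝[>] 0) := by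
      rw [nhdsWithin, nhdsWithin, comap_inf, comap_principal,
        NNReal.isEmbedding_coe.isInducing.nhds_eq_comap, NNReal.coe_zero]
      congr 2
    rw [h, comap_comap]
    rfl
  have hrange : Set.range (fun ε : Set.Ioi (0 : ℝ≥0) => ((ε : ℝ≥0) : ℝ)) ∈ 𝓝[>] (0 : ℝ) := by
    refine mem_of_superset self_mem_nhdsWithin fun ε (hε : 0 < ε) => ?_
    exact ⟨⟨⟨ε, hε.le⟩, hε⟩, rfl⟩
  rw [← tendsto_comap'_iff hrange, ← hfilter, RankPolicy.IsWitness,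
    ← ENNReal.tendsto_toReal_iff (fun ε => measure_ne_top _ _) ENNReal.one_ne_top,
    ENNReal.toReal_one]
  refine tendsto_congr fun ε => ?_
  have hε : (0 : ℝ≥0) < ε := ε.2
  simp [reachProbAt, hε]

theorem verifier_iff_isWitness : verifier I.table I.mdp.s₀ I.target I.ranks = true ↔
    I.policy.IsWitness I.mdp I.target := by
  obtain ⟨K, hK, hcost⟩ := I.exists_near_cost
  obtain ⟨K', hK', h⟩ := exists_near_foldl_elimFirst I.n hK
  rw [isWitness_iff_tendsto_reachProbAt, verifier, List.foldl_const, initialRows_eq, startRow_eq,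
    table, List.length_ofFn]
  refine (tendsto_one_iff_costLT hK' fun ε hε hε1 => ?_).symm
  have hε' : 0 < ε.toNNReal := Real.toNNReal_pos.2 hε
  have hεcoe : (ε.toNNReal : ℝ) = ε := Real.coe_toNNReal ε hε.le
  obtain ⟨d, t, hd, ht, hy⟩ := h ε hε hε1 (List.ofFn I.costRow)
    (none, (List.ofFn fun s : Fin I.n => if s = I.mdp.s₀ then some 0 else none) ++ [none])
    (List.ofFn (I.rateRow ε.toNNReal)) I.startRateRow (by simp)
    (List.forall₂_ofFn.2 fun s => by
      unfold costRow rateRow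
      split_ifs
      · exact rowNear_append (fun _ => rfl) (Near.one hK)
      · refine rowNear_append (fun s' => ?_) rfl
        have := hcost ε.toNNReal hε' (Real.toNNReal_le_one.2 hε1) s s'
        rwa [hεcoe] at this)
    (rowNear_append (fun s => by
      split_ifs
      exacts [Near.one hK, rfl]) rfl)
    (by
      intro u hu
      obtain ⟨s, rfl⟩ := List.mem_ofFn.1 hu
      unfold rateRow
      split_ifs <;> simp)
    (by simp [startRateRow])
  refine ⟨d, t, hd, ht, ?_⟩
  have := I.isLeast_reachProb ⟨ε.toNNReal, hε'⟩
  simp only [hy] at this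
  rw [reachProbAt, dif_pos hε']
  exact this

end VerifierInput

theorem mainTheorem5 :
    DecidableInPolyTime VerifierInput.encode
      (fun I => I.policy.IsWitness I.mdp I.target) := by
  exact decidableInPolyTime_of_polyTime VerifierInput.polyTime_verifier
    VerifierInput.verifier_iff_isWitness
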